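/- **Setting.** Let $f,g:\mathbb R^n\to\mathbb R^n$ be $C^\infty$ with $f(0)=0$ and consider the single-input system $\dot x=f(x)+u\,g(x)$, $u\in\mathbb R$. For a vector field $X$ and a function $W$ put $XW:=(DW)X$, $X^{1}W:=XW$, $X^{i}W:=X(X^{i-1}W)$, and let $[X,Y]:=(DY)X-(DX)Y$. Let $L_1:=\mathrm{span}\{f,g\}$ and $L_{i+1}:=\mathrm{span}\{[X,Y]: X\in L_i,\,Y\in L_1\}$. Leaving out the generator $g$, put $M_1:=\mathrm{span}\{f\}$ and $M_i:=L_i$ for $i\ge 2$; a vector field $\Delta$ has order $k\ge 1$ if $\Delta=\Delta_1+\Delta_2$ with $0\ne\Delta_1\in M_k$ and $\Delta_2\in\mathrm{span}\bigcup_{i<k}M_i$. **Notions.** Trajectories are Carathéodory solutions; controls are measurable and locally essentially bounded ("admissible"); a partition of times is a sequence $0=t_1<t_2<\cdots$ with $t_\nu\to\infty$. *Assumption 1 with $(V,a)$*: $V:\mathbb R^n\to[0,\infty)$ is continuous and positive definite, $a$ is continuous and strictly increasing on $[0,\infty)$ with $a(0)=0$, and for every $\xi>0$ and $x_0\ne0$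 there are $\varepsilon\in(0,\xi]$ and an admissible $u:[0,\varepsilon]\to\mathbb R$ such that the trajectory $x(\cdot)$ with $x(0)=x_0$ and control $u$ exists on $[0,\varepsilon]$, $V(x(\varepsilon))<V(x_0)$, and $V(x(s))\le a(V(x_0))$ for all $s\in[0,\varepsilon]$. *Assumption 1* holds if it holds with some $(V,a)$. *SDF-SGAS*: for every $R>0$ and every partition of times $(T_i)$ there are a neighbourhood $\Pi$ of $0$ containing $\{|x|\le R\}$ and a map $k:[0,\infty)\times\Pi\to\mathbb R$, with $k(\cdot,z)$ admissible for each $z\in\Pi$, such that for each $x(0)\in\Pi$ the closed loop $\dot x(t)=f(x(t))+k(t,x(T_i))\,g(x(t))$, $t\in[T_i,T_{i+1})$, has a trajectory on $[0,\infty)$ (with all $x(T_i)\in\Pi$); for every $\varepsilon>0$ there is $\delta>0$ such that $x(0)\in\Pi$, $|x(0)|\le\delta$ imply $|x(t)|\le\varepsilon$ for all $t\ge0$; and $x(t)\to0$ as $t\to\infty$ for every $x(0)\in\Pi$. *SDF-WGAS*: for every $\tau>0$ there are $T:\mathbb R^n\setminus\{0\}\to(0,\tau]$, a map $k(t,z;x_0)$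 admissible in $t\ge 0$ for fixed $(z,x_0)$, and for each initial state $x_0$ a partition of times $(t_i)$, such that the closed loop $\dot x(t)=f(x(t))+k(t,x(t_i);x_0)\,g(x(t))$, $t\in[t_i,t_{i+1})$, $x(0)=x_0$, has a trajectory on $[0,\infty)$; $t_{i+1}-t_i=T(x(t_i))$ whenever $x(t_i)\ne0$; for every $\varepsilon>0$ there is $\delta>0$ such that $|x_0|\le\delta$ implies $|x(t)|\le\varepsilon$ for all $t\ge0$; and $x(t)\to0$ as $t\to\infty$ for every $x_0\in\mathbb R^n$. **Proposition 3.** Let $V:\mathbb R^n\to[0,\infty)$ be $C^\infty$, positive definite and proper. Assume that at every $x\ne0$ with $(gV)(x)=0$, either $(fV)(x)<0$, or there is an integer $N=N(x)\ge1$ such that - $(f^iV)(x)=0$ for $i=1,\dots,N$, and $(\Delta_1\Delta_2\cdots\Delta_kV)(x)=0$ for all $k\ge1$ and all vector fields $\Delta_1,\dots,\Delta_k$ having orders (in the sense above) with sum at most $N$; and - at least one of the following holds: - (P1) $(f^{N+1}V)(x)<0$; - (P2) $N$ is odd and $([\ldots[[f,g],g],\ldots,g]V)(x)\ne0$, with $N$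 copies of $g$; - (P3) $N$ is even and $([\ldots[[f,g],g],\ldots,g]V)(x)<0$, with $N$ copies of $g$; - (P4) $(f^{N+1}V)(x)=0$ and $([\ldots[[g,f],f],\ldots,f]V)(x)\ne0$, with $N$ copies of $f$. Then Assumption 1 holds with this $V$ and $a(s)=2s$; hence the system is SDF-SGAS and therefore SDF-WGAS. -/

import Mathlib

open MeasureTheory Set Filter Topology
open scoped ContDiff

namespace SampledData

section Systems

variable {E U : Type*} [NormedAddCommGroup E] [NormedSpace ℝ E] [NormedAddCommGroup U]

/-- The control `u` is (Lebesgue) measurable and locally essentially bounded on the set `s` of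
times. -/
def IsAdmissibleOn (u : ℝ → U) (s : Set ℝ) : Prop :=
  AEStronglyMeasurable u (volume.restrict s) ∧
    ∀ a b : ℝ, Icc a b ⊆ s → ∃ C : ℝ, ∀ᵐ t ∂(volume.restrict (Icc a b)), ‖u t‖ ≤ C

/-- `x` is a (Carathéodory) trajectory of `ẋ = F(x, u(t))` on the time interval `[a, b]`. -/
def IsTrajectoryOn (F : E → U → E) (u : ℝ → U) (a b : ℝ) (x : ℝ → E) : Prop :=
  ContinuousOn x (Icc a b) ∧
    IntervalIntegrable (fun s => F (x s) (u s)) volume a b ∧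
    ∀ t ∈ Icc a b, x t = x a + ∫ s in a..t, F (x s) (u s)

/-- A partition of times `0 = T₀ < T₁ < T₂ < ⋯` with `T_ν → ∞`. -/
def IsTimePartition (T : ℕ → ℝ) : Prop :=
  T 0 = 0 ∧ StrictMono T ∧ Tendsto T atTop atTop

/-- `x` is a trajectory, on `[0, ∞)`, of the sampled-data closed-loop system
`ẋ = F(x, k(t, x(T_i)))`, `t ∈ [T_i, T_{i+1})`, for a time-varying feedback `k` whose domain is
`[0, ∞) × P`; the sampled states have to lie in `P`. -/
def IsSampledTrajectory (F : E → U → E) (P : Set E) (k : ℝ → E → U) (T : ℕ → ℝ)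
    (x : ℝ → E) : Prop :=
  ∀ i : ℕ, x (T i) ∈ P ∧ IsTrajectoryOn F (fun t => k t (x (T i))) (T i) (T (i + 1)) x

/-- Semi-global asymptotic stabilizability by means of a time-varying sampled-data feedback. -/
def SDFSGAS (F : E → U → E) : Prop :=
  ∀ R : ℝ, 0 < R → ∀ T : ℕ → ℝ, IsTimePartition T →
    ∃ P : Set E, P ∈ 𝓝 (0 : E) ∧ Metric.closedBall 0 R ⊆ P ∧
    ∃ k : ℝ → E → U,
      (∀ z ∈ P, IsAdmissibleOn (fun t => k t z) (Ici 0)) ∧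
      -- every initial state in `P` has a closed-loop trajectory defined for all `t ≥ 0`
      (∀ x₀ ∈ P, ∃ x : ℝ → E, IsSampledTrajectory F P k T x ∧ x 0 = x₀) ∧
      -- stability
      (∀ ε : ℝ, 0 < ε → ∃ δ : ℝ, 0 < δ ∧ ∀ x : ℝ → E, IsSampledTrajectory F P k T x →
        ‖x 0‖ ≤ δ → ∀ t : ℝ, 0 ≤ t → ‖x t‖ ≤ ε) ∧
      -- attractivity
      (∀ x : ℝ → E, IsSampledTrajectory F P k T x → Tendsto x atTop (𝓝 0))

/-- Weak global asymptotic stabilizability by sampled-data feedback. The sampling times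
`t x₀ 0, t x₀ 1, …` depend on the initial state `x₀`, and the length of a sampling interval is the
value of the map `T`, defined off the origin, at the sampled state. -/
def SDFWGAS (F : E → U → E) : Prop :=
  ∀ τ : ℝ, 0 < τ →
    ∃ (T : {z : E // z ≠ 0} → ℝ) (k : ℝ → E → E → U) (t : E → ℕ → ℝ),
      (∀ z, 0 < T z ∧ T z ≤ τ) ∧
      (∀ z x₀ : E, IsAdmissibleOn (fun s => k s z x₀) (Ici 0)) ∧
      (∀ x₀ : E, IsTimePartition (t x₀)) ∧
      -- every initial state has a closed-loop trajectory defined for all times `≥ 0`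
      (∀ x₀ : E, ∃ x : ℝ → E,
        IsSampledTrajectory F univ (fun s z => k s z x₀) (t x₀) x ∧ x 0 = x₀) ∧
      -- the sampling times are produced by `T` along the trajectory
      (∀ (x₀ : E) (x : ℝ → E),
        IsSampledTrajectory F univ (fun s z => k s z x₀) (t x₀) x → x 0 = x₀ →
        ∀ (i : ℕ) (h : x (t x₀ i) ≠ 0), t x₀ (i + 1) - t x₀ i = T ⟨x (t x₀ i), h⟩) ∧
      -- stability
      (∀ ε : ℝ, 0 < ε → ∃ δ : ℝ, 0 < δ ∧ ∀ (x₀ : E) (x : ℝ → E),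
        IsSampledTrajectory F univ (fun s z => k s z x₀) (t x₀) x → x 0 = x₀ →
        ‖x₀‖ ≤ δ → ∀ s : ℝ, 0 ≤ s → ‖x s‖ ≤ ε) ∧
      -- attractivity
      (∀ (x₀ : E) (x : ℝ → E),
        IsSampledTrajectory F univ (fun s z => k s z x₀) (t x₀) x → x 0 = x₀ →
        Tendsto x atTop (𝓝 0))

/-- Positive definiteness of a function `V : E → [0, ∞)`. -/
def IsPosDef (V : E → ℝ) : Prop :=
  V 0 = 0 ∧ ∀ x : E, x ≠ 0 → 0 < V x

/-- Properness of a function `V : E → [0, ∞)`: `V(x) → ∞` as `x` leaves every compact set. -/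
def IsProper (V : E → ℝ) : Prop :=
  Tendsto V (cocompact E) atTop

/-- The class `K` of comparison functions on `[0, ∞)`. -/
def IsClassK (a : ℝ → ℝ) : Prop :=
  ContinuousOn a (Ici 0) ∧ StrictMonoOn a (Ici 0) ∧ a 0 = 0

/-- `V` and `a` witness the generalized control Lyapunov property of `ẋ = F(x, u)`: from every
`x₀ ≠ 0`, for arbitrarily small `ε > 0`, some admissible control on `[0, ε]` makes `V` strictly
smaller at time `ε`, while `V ≤ a(V(x₀))` during the whole interval. -/
structure LyapunovAssumptionWith (F : E → U → E) (V : E → ℝ) (a : ℝ → ℝ) : Prop where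
  continuous : Continuous V
  posDef : IsPosDef V
  classK : IsClassK a
  decrease : ∀ ξ : ℝ, 0 < ξ → ∀ x₀ : E, x₀ ≠ 0 →
    ∃ ε : ℝ, 0 < ε ∧ ε ≤ ξ ∧ ∃ u : ℝ → U, IsAdmissibleOn u (Icc 0 ε) ∧
      (∃ x : ℝ → E, IsTrajectoryOn F u 0 ε x ∧ x 0 = x₀) ∧
      ∀ x : ℝ → E, IsTrajectoryOn F u 0 ε x → x 0 = x₀ →
        V (x ε) < V x₀ ∧ ∀ s ∈ Icc 0 ε, V (x s) ≤ a (V x₀)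

/-- The generalized control Lyapunov property of the system `ẋ = F(x, u)`. -/
def LyapunovAssumption (F : E → U → E) : Prop :=
  ∃ (V : E → ℝ) (a : ℝ → ℝ), LyapunovAssumptionWith F V a

end Systems

section LieAlgebra

variable {E : Type*} [NormedAddCommGroup E] [NormedSpace ℝ E]

/-- The single-input affine system `ẋ = f(x) + u g(x)`. -/
def affineSystem (f g : E → E) : E → ℝ → E := fun x u => f x + u • g x

/-- `XW := (DW) X`, the derivative of the function `W` along the vector field `X`. -/
noncomputable def along (X : E → E) (W : E → ℝ) : E → ℝ := fun x => fderiv ℝ W x (X x)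

/-- `Δ₁ Δ₂ ⋯ Δ_k V = Δ₁ (Δ₂ (⋯ (Δ_k V)))`. -/
noncomputable def alongList (Δ : List (E → E)) (V : E → ℝ) : E → ℝ := Δ.foldr along V

/-- `[[…[[X, Y], Y], …, Y], Y]` with `N` copies of `Y`, where `[X, Y] = (DY) X - (DX) Y`. -/
noncomputable def iterBracket (X Y : E → E) (N : ℕ) : E → E :=
  (fun Z => VectorField.lieBracket ℝ Z Y)^[N] X

/-- `L₁ = span {f, g}` and `L_{i+1} = span {[X, Y] : X ∈ L_i, Y ∈ L₁}`. (Index `0` is unused.) -/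
noncomputable def lieLayer (f g : E → E) : ℕ → Submodule ℝ (E → E)
  | 0 => ⊥
  | 1 => Submodule.span ℝ {f, g}
  | i + 2 => Submodule.span ℝ
      {Z | ∃ X ∈ lieLayer f g (i + 1), ∃ Y ∈ Submodule.span ℝ {f, g},
        Z = VectorField.lieBracket ℝ X Y}

/-- The layers that remain when the generator `g` is left out: `span {f}` in order one, and `L_i`
in order `i ≥ 2`. -/
noncomputable def lieLayerWithoutG (f g : E → E) : ℕ → Submodule ℝ (E → E)
  | 1 => Submodule.span ℝ {f}
  | i => lieLayer f g i

/-- `Δ` belongs to the part of `Lie {f, g}` built without the generator `g`, and is of order `k`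
there: `Δ = Δ₁ + Δ₂` with `Δ₁ ≠ 0` in the layer of order `k` and `Δ₂` in the span of the layers of
smaller order. -/
def HasOrderWithoutG (f g : E → E) (Δ : E → E) (k : ℕ) : Prop :=
  ∃ Δ₁ ∈ lieLayerWithoutG f g k, Δ₁ ≠ 0 ∧
    ∃ Δ₂ ∈ ⨆ i ∈ Finset.Ico 1 k, lieLayerWithoutG f g i, Δ = Δ₁ + Δ₂

/-- The vanishing condition of order `N` at `x`: `gV`, `fV, f²V, …, f^N V` vanish at `x`, and so
does `Δ₁ Δ₂ ⋯ Δ_k V` whenever `k ≥ 1` and the `Δ_p` are elements of `Lie {f, g}`, built without the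
generator `g`, of total order at most `N`. A pair `p` in the list stands for a vector field `p.1`
together with its order `p.2`. -/
def VanishesToOrder (f g : E → E) (V : E → ℝ) (N : ℕ) (x : E) : Prop :=
  along g V x = 0 ∧
  (∀ i : ℕ, 1 ≤ i → i ≤ N → (along f)^[i] V x = 0) ∧
  ∀ l : List ((E → E) × ℕ), l ≠ [] → (∀ p ∈ l, HasOrderWithoutG f g p.1 p.2) →
    (l.map Prod.snd).sum ≤ N → alongList (l.map Prod.fst) V x = 0

end LieAlgebra

end SampledData

/-!
Away from the origin, arbitrarily short controls decrease `V`; this local fact is `HasDescent`,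
and all the conclusions follow from it.

**Local descent.** Where `gV ≠ 0`, where `fV < 0`, and where the first nonvanishing `f^i V` is
negative, a constant control decreases `V` (`hasDescent_of_const`). In the other cases the
control acts through its primitive `w`. Undoing the flow of `g` for the time `w(s)`, by means of
truncated Taylor expansions (`transported`), removes `g` from the equation and leaves a system
driven by the brackets `[[…[f, g], …], g]`, the bracket with `i` copies of `g` having the
coefficient `w^i / i!` (`exists_hasDerivWithinAt_transported`). If `w` vanishes at both ends of
the time interval, which has length `h²`, the transported function is `V` there.

* With `w` of size `h`, the vanishing conditions leave the single bracket with `N` copies of `g`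
  as the dominant term (`isOrder_transported_sub_bracket`). It has the coefficient `∫ w^N / N!`,
  whose sign is positive for even `N` and at choice for odd `N`.
* With `w` of size `h³`, the power `f^(N + 1)` would dominate, but it annihilates `V`. The next
  terms are the words `f^i [f, g] f^j` with `i + j = N - 1` (`isOrder_telescope_sub`). They
  contribute the integral of `w` against the polynomial `mixedPoly`, whose coefficient in degree
  `N - 1` is a nonzero multiple of `([[…[g, f], …], f] V)(x)` (`coeff_mixedPoly`). As the
  polynomial is not zero, some `w` makes the integral negative.

**Uniform decrease.** The flows that realize the descent depend continuously on the initial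
state, so that compactness of the sublevel sets gives a time in which `{V ≤ c}` is steered into
`{V ≤ c / 2}` inside `{V ≤ 2 c}` (`exists_halving_time`). Concatenation yields open-loop
controls with prescribed bounds on `V`, namely `2 c_m` at all times and `2 c_i` after the time
`Θ_i` (`Controllable`, `controllable_of_stages`).

**Feedback.** At a sampled state the feedback uses an open-loop control for the largest `m` for
which these bounds are achievable (`exists_optimal_control`). The remaining part of that control
shows that the same `m` is achievable at the next sampled state. Hence the bounds hold along the
closed loop, for every partition of times, which is semi-global stabilizability. For weak global
stabilizability the initial state selects the radius of a semi-global feedback with a constant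
sampling period.
-/

namespace SampledData

/-! ### Trajectories: restriction, concatenation, translation in time, uniqueness -/

section Trajectories

variable {E U : Type*} [NormedAddCommGroup E] [NormedSpace ℝ E]
  {F : E → U → E} {u u' : ℝ → U} {x x' : ℝ → E} {a b c d : ℝ}

lemma IsTrajectoryOn.mono (h : IsTrajectoryOn F u a b x) (hac : a ≤ c) (hcd : c ≤ d)
    (hdb : d ≤ b) : IsTrajectoryOn F u c d x := by
  obtain ⟨h1, h2, h3⟩ := h
  have hi : ∀ p q, p ∈ Icc a b → q ∈ Icc a b →
      IntervalIntegrable (fun s => F (x s) (u s)) volume p q := fun p q hp hq =>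
    h2.mono_set (by
      rw [uIcc_of_le (a := a) (b := b) (hac.trans (hcd.trans hdb))]
      exact uIcc_subset_Icc hp hq)
  have hc : c ∈ Icc a b := ⟨hac, hcd.trans hdb⟩
  have hd : d ∈ Icc a b := ⟨hac.trans hcd, hdb⟩
  refine ⟨h1.mono (Icc_subset_Icc hac hdb), hi c d hc hd, fun t ht => ?_⟩
  have ht' : t ∈ Icc a b := ⟨hac.trans ht.1, ht.2.trans hdb⟩
  have ha : a ∈ Icc a b := ⟨le_rfl, hac.trans hc.2⟩
  rw [h3 t ht', h3 c hc, add_assoc,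
    intervalIntegral.integral_add_adjacent_intervals (hi a c ha hc) (hi c t hc ht')]

lemma IsTrajectoryOn.congr (h : IsTrajectoryOn F u a b x) (hab : a ≤ b)
    (hu : ∀ t ∈ Ioo a b, u t = u' t) (hx : EqOn x x' (Icc a b)) :
    IsTrajectoryOn F u' a b x' := by
  obtain ⟨h1, h2, h3⟩ := h
  have key : ∀ t ∈ Icc a b, EqOn (fun s => F (x s) (u s)) (fun s => F (x' s) (u' s))
      (Ioo a t) := fun t ht s hs => by
    have hs' : s ∈ Ioo a b := ⟨hs.1, hs.2.trans_le ht.2⟩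
    simp only [hu s hs', hx (Ioo_subset_Icc_self hs')]
  have hae : ∀ t ∈ Icc a b, (fun s => F (x s) (u s)) =ᵐ[volume.restrict (uIoc a t)]
      (fun s => F (x' s) (u' s)) := fun t ht => by
    rw [uIoc_of_le ht.1, ← restrict_Ioo_eq_restrict_Ioc]
    exact (ae_restrict_iff' measurableSet_Ioo).2 (Eventually.of_forall (key t ht))
  refine ⟨h1.congr fun t ht => (hx ht).symm, ?_, fun t ht => ?_⟩
  · exact h2.congr_ae (hae b (right_mem_Icc.2 hab))
  · rw [← hx ht, ← hx (left_mem_Icc.2 hab), h3 t ht]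
    congr 1
    exact intervalIntegral.integral_congr_ae_restrict (hae t ht)

lemma IsTrajectoryOn.append (h₁ : IsTrajectoryOn F u a b x) (h₂ : IsTrajectoryOn F u b c x)
    (hab : a ≤ b) (hbc : b ≤ c) : IsTrajectoryOn F u a c x := by
  refine ⟨?_, h₁.2.1.trans h₂.2.1, fun t ht => ?_⟩
  · rw [← Icc_union_Icc_eq_Icc hab hbc]
    exact h₁.1.union_of_isClosed h₂.1 isClosed_Icc isClosed_Icc
  · rcases le_total t b with htb | hbt
    · exact h₁.2.2 t ⟨ht.1, htb⟩
    · have hi : IntervalIntegrable (fun s => F (x s) (u s)) volume b t :=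
        (h₂.mono le_rfl hbt ht.2).2.1
      rw [h₂.2.2 t ⟨hbt, ht.2⟩, h₁.2.2 b ⟨hab, le_rfl⟩, add_assoc,
        intervalIntegral.integral_add_adjacent_intervals h₁.2.1 hi]

lemma IsTrajectoryOn.comp_add_right (h : IsTrajectoryOn F u a b x) (c : ℝ) :
    IsTrajectoryOn F (fun t => u (t + c)) (a - c) (b - c) (fun t => x (t + c)) := by
  obtain ⟨h1, h2, h3⟩ := h
  refine ⟨?_, h2.comp_add_right c, fun t ht => ?_⟩
  · refine h1.comp (by fun_prop) fun t ht => ?_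
    constructor <;> linarith [ht.1, ht.2]
  · have := h3 (t + c) ⟨by linarith [ht.1], by linarith [ht.2]⟩
    rw [intervalIntegral.integral_comp_add_right (fun s => F (x s) (u s)) c]
    simpa using this

lemma isTrajectoryOn_self (F : E → U → E) (u : ℝ → U) (a : ℝ) (x : ℝ → E) :
    IsTrajectoryOn F u a a x :=
  ⟨by simp, by simp, fun t ht => by
    obtain rfl : t = a := le_antisymm ht.2 ht.1
    simp⟩

end Trajectories

section Affine

variable {E : Type*} [NormedAddCommGroup E] [NormedSpace ℝ E] {f g : E → E}
  {u : ℝ → ℝ} {x x' : ℝ → E} {a b : ℝ}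

/-- A classical solution for a continuous control is a trajectory. -/
lemma isTrajectoryOn_of_hasDerivWithinAt [CompleteSpace E] (hf : Continuous f)
    (hg : Continuous g) (hu : Continuous u) (hab : a ≤ b)
    (hx : ∀ t ∈ Icc a b, HasDerivWithinAt x (f (x t) + u t • g (x t)) (Icc a b) t) :
    IsTrajectoryOn (affineSystem f g) u a b x := by
  have hc : ContinuousOn x (Icc a b) := fun t ht => (hx t ht).continuousWithinAt
  have hF : ContinuousOn (fun s => f (x s) + u s • g (x s)) (Icc a b) :=
    (hf.comp_continuousOn hc).add (hu.continuousOn.smul (hg.comp_continuousOn hc))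
  refine ⟨hc, ?_, fun t ht => ?_⟩
  · exact ContinuousOn.intervalIntegrable (by rwa [uIcc_of_le hab])
  · have hsub : Icc a t ⊆ Icc a b := Icc_subset_Icc le_rfl ht.2
    have := intervalIntegral.integral_eq_sub_of_hasDeriv_right_of_le ht.1 (hc.mono hsub)
      (f' := fun s => f (x s) + u s • g (x s)) (fun s hs => ?_)
      (ContinuousOn.intervalIntegrable (by rw [uIcc_of_le ht.1]; exact hF.mono hsub))
    · simp only [affineSystem]
      rw [this]; abel
    · have hs' : s ∈ Ioo a b := ⟨hs.1, hs.2.trans_le ht.2⟩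
      exact ((hx s (Ioo_subset_Icc_self hs')).hasDerivAt
        (Icc_mem_nhds hs'.1 hs'.2)).hasDerivWithinAt

/-- A nonnegative continuous function dominated by a multiple of its own integral vanishes. -/
lemma eq_zero_of_le_mul_integral {φ : ℝ → ℝ} {K : ℝ} (hφ : ContinuousOn φ (Icc a b))
    (h0 : ∀ t ∈ Icc a b, 0 ≤ φ t)
    (h : ∀ t ∈ Icc a b, φ t ≤ K * ∫ s in a..t, φ s) : ∀ t ∈ Icc a b, φ t = 0 := by
  intro t ht
  have hab : a ≤ b := ht.1.trans ht.2
  have hi : IntervalIntegrable φ volume a b :=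
    ContinuousOn.intervalIntegrable (by rwa [uIcc_of_le hab])
  have hpos : ∀ s ∈ Icc a b, 0 ≤ ∫ r in a..s, φ r := fun s hs =>
    intervalIntegral.integral_nonneg hs.1 fun r hr => h0 r ⟨hr.1, hr.2.trans hs.2⟩
  have hz := eq_zero_of_abs_deriv_le_mul_abs_self_of_eq_zero_right (a := a) (b := b) (K := K)
    (f := fun t => ∫ s in a..t, φ s) (f' := φ) ?_ ?_ (by simp) ?_ t ht
  · exact le_antisymm (by simpa [hz] using h t ht) (h0 t ht)
  · have := intervalIntegral.continuousOn_primitive_interval (μ := volume) (a := a) (b := b)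
      (f := φ) (by rw [uIcc_of_le hab]; exact hφ.integrableOn_Icc)
    rwa [uIcc_of_le hab] at this
  · intro s hs
    have hs' : s ∈ Icc a b := ⟨hs.1, hs.2.le⟩
    refine intervalIntegral.integral_hasDerivWithinAt_right
      (hi.mono_set (by rw [uIcc_of_le hab, uIcc_of_le hs.1]; exact Icc_subset_Icc le_rfl hs.2.le))
      (t := Ioi s) ?_ ?_
    · refine ⟨Ioc s b, Ioc_mem_nhdsGT hs.2, ?_⟩
      exact (hφ.mono fun r hr => ⟨hs.1.trans hr.1.le, hr.2⟩).aestronglyMeasurable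
        measurableSet_Ioc
    · exact (hφ s hs').mono_of_mem_nhdsWithin
        (mem_of_superset (Ioc_mem_nhdsGT hs.2) fun r hr => ⟨hs.1.trans hr.1.le, hr.2⟩)
  · intro s hs
    have hs' : s ∈ Icc a b := ⟨hs.1, hs.2.le⟩
    rw [Real.norm_of_nonneg (h0 s hs'), Real.norm_of_nonneg (hpos s hs')]
    exact h s hs'

/-- Trajectories of a `C¹` affine system under an admissible control are determined by their
initial state. -/
lemma IsTrajectoryOn.eqOn [FiniteDimensional ℝ E] (hf : ContDiff ℝ 1 f) (hg : ContDiff ℝ 1 g)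
    (hu : IsAdmissibleOn u (Icc a b)) (hx : IsTrajectoryOn (affineSystem f g) u a b x)
    (hx' : IsTrajectoryOn (affineSystem f g) u a b x') (h0 : x a = x' a) :
    EqOn x x' (Icc a b) := by
  have := FiniteDimensional.complete ℝ E
  have := FiniteDimensional.proper ℝ E
  rcases lt_or_ge b a with hab | hab
  · simp [Icc_eq_empty_of_lt hab]
  obtain ⟨r, hr⟩ := (((isCompact_Icc (a := a) (b := b)).image_of_continuousOn hx.1).union
    (isCompact_Icc.image_of_continuousOn hx'.1)).isBounded.subset_closedBall (0 : E)
  have hB : IsCompact (Metric.closedBall (0 : E) r) := isCompact_closedBall 0 r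
  obtain ⟨Kf, hKf⟩ := hf.contDiffOn.exists_lipschitzOnWith one_ne_zero (convex_closedBall 0 r) hB
  obtain ⟨Kg, hKg⟩ := hg.contDiffOn.exists_lipschitzOnWith one_ne_zero (convex_closedBall 0 r) hB
  obtain ⟨C, hC⟩ := hu.2 a b le_rfl
  have hmem : ∀ s ∈ Icc a b, x s ∈ Metric.closedBall (0 : E) r := fun s hs =>
    hr (Or.inl (mem_image_of_mem x hs))
  have hmem' : ∀ s ∈ Icc a b, x' s ∈ Metric.closedBall (0 : E) r := fun s hs =>
    hr (Or.inr (mem_image_of_mem x' hs))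
  set K : ℝ := Kf + |C| * Kg with hKdef
  have hcont : ContinuousOn (fun s => ‖x s - x' s‖) (Icc a b) := (hx.1.sub hx'.1).norm
  have hzero := eq_zero_of_le_mul_integral (K := K) hcont (fun _ _ => norm_nonneg _) ?_
  · intro t ht
    exact sub_eq_zero.1 (norm_eq_zero.1 (hzero t ht))
  intro t ht
  have hsub : Icc a t ⊆ Icc a b := Icc_subset_Icc le_rfl ht.2
  have hi := (hx.mono le_rfl ht.1 ht.2).2.1
  have hi' := (hx'.mono le_rfl ht.1 ht.2).2.1
  rw [hx.2.2 t ht, hx'.2.2 t ht, h0, add_sub_add_left_eq_sub,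
    ← intervalIntegral.integral_sub hi hi', ← intervalIntegral.integral_const_mul]
  refine intervalIntegral.norm_integral_le_of_norm_le ht.1 ?_
    (ContinuousOn.intervalIntegrable (by
      rw [uIcc_of_le ht.1]; exact continuousOn_const.mul (hcont.mono hsub)))
  have hC' := ae_imp_of_ae_restrict hC
  filter_upwards [hC'] with s hs hst
  have hs' : s ∈ Icc a b := ⟨hst.1.le, hst.2.trans ht.2⟩
  have hus : |u s| ≤ |C| := (hs hs').trans (le_abs_self C)
  have e : affineSystem f g (x s) (u s) - affineSystem f g (x' s) (u s) =
      (f (x s) - f (x' s)) + u s • (g (x s) - g (x' s)) := by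
    simp only [affineSystem, smul_sub]; abel
  have h1 := hKf.norm_sub_le (hmem s hs') (hmem' s hs')
  have h2 := hKg.norm_sub_le (hmem s hs') (hmem' s hs')
  rw [e]
  calc _ ≤ ‖f (x s) - f (x' s)‖ + |u s| * ‖g (x s) - g (x' s)‖ := by
        refine (norm_add_le _ _).trans ?_
        rw [norm_smul, Real.norm_eq_abs]
    _ ≤ Kf * ‖x s - x' s‖ + |C| * (Kg * ‖x s - x' s‖) := by gcongr
    _ = K * ‖x s - x' s‖ := by rw [hKdef]; ring

end Affine

/-! ### Lie derivatives as operators on smooth functions -/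

section Operators

variable {E : Type*} [NormedAddCommGroup E] [NormedSpace ℝ E]

variable (E) in
/-- The real vector space of smooth real-valued functions on `E`. -/
def smoothFunctions : Submodule ℝ (E → ℝ) where
  carrier := {W | ContDiff ℝ ∞ W}
  add_mem' h₁ h₂ := by
    rw [mem_ofPred_eq] at h₁ h₂ ⊢
    exact h₁.add h₂
  zero_mem' := by
    rw [mem_ofPred_eq]
    exact contDiff_const
  smul_mem' c _ h := by
    rw [mem_ofPred_eq] at h ⊢
    exact contDiff_const.smul h

lemma mem_smoothFunctions {W : E → ℝ} : W ∈ smoothFunctions E ↔ ContDiff ℝ ∞ W := Iff.rfl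

lemma contDiff_coe (W : smoothFunctions E) : ContDiff ℝ ∞ (W : E → ℝ) :=
  mem_smoothFunctions.1 W.2

lemma contDiff_along {X : E → E} {W : E → ℝ} (hX : ContDiff ℝ ∞ X) (hW : ContDiff ℝ ∞ W) :
    ContDiff ℝ ∞ (along X W) :=
  (hW.fderiv_right (m := ∞) (by simp)).clm_apply hX

/-- The derivation of the smooth functions defined by a smooth vector field. -/
noncomputable def lieD {X : E → E} (hX : ContDiff ℝ ∞ X) :
    Module.End ℝ (smoothFunctions E) where
  toFun W := ⟨along X W, mem_smoothFunctions.2 (contDiff_along hX (contDiff_coe W))⟩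
  map_add' W₁ W₂ := by
    ext x
    have h₁ : DifferentiableAt ℝ (W₁ : E → ℝ) x := ((contDiff_coe W₁).differentiable (by simp)) x
    have h₂ : DifferentiableAt ℝ (W₂ : E → ℝ) x := ((contDiff_coe W₂).differentiable (by simp)) x
    simp [along, fderiv_add h₁ h₂]
  map_smul' c W := by
    ext x
    have h₁ : DifferentiableAt ℝ (W : E → ℝ) x := ((contDiff_coe W).differentiable (by simp)) x
    simp [along, fderiv_const_smul h₁]

@[simp] lemma coe_lieD {X : E → E} (hX : ContDiff ℝ ∞ X) (W : smoothFunctions E) :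
    (lieD hX W : E → ℝ) = along X W := rfl

lemma coe_lieD_pow {X : E → E} (hX : ContDiff ℝ ∞ X) (W : smoothFunctions E) (k : ℕ) :
    ((lieD hX ^ k) W : E → ℝ) = (along X)^[k] W := by
  induction k with
  | zero => simp
  | succ k ih => rw [pow_succ', Function.iterate_succ_apply', Module.End.mul_apply, coe_lieD, ih]

lemma contDiff_lieBracket {X Y : E → E} (hX : ContDiff ℝ ∞ X) (hY : ContDiff ℝ ∞ Y) :
    ContDiff ℝ ∞ (VectorField.lieBracket ℝ X Y) :=
  hX.lieBracket_vectorField hY (by simp)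

lemma lieD_lieBracket {X Y : E → E} (hX : ContDiff ℝ ∞ X) (hY : ContDiff ℝ ∞ Y) :
    lieD (contDiff_lieBracket hX hY) = lieD hX * lieD hY - lieD hY * lieD hX := by
  ext W x
  have hW : ContDiff ℝ ∞ (W : E → ℝ) := contDiff_coe W
  have := VectorField.fderiv_apply_lieBracket (𝕜 := ℝ) (V := X) (W := Y) (x := x)
    (contDiff_infty.1 hW 2).contDiffAt (by simp) (hY.differentiable (by simp) x)
    (hX.differentiable (by simp) x)
  exact this

/-- The constant functions, as smooth functions. -/
def constFn (c : ℝ) : smoothFunctions E :=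
  ⟨fun _ => c, mem_smoothFunctions.2 contDiff_const⟩

@[simp] lemma constFn_apply (c : ℝ) (x : E) : (constFn c : smoothFunctions E).1 x = c := rfl

@[simp] lemma lieD_constFn {X : E → E} (hX : ContDiff ℝ ∞ X) (c : ℝ) :
    lieD hX (constFn c) = 0 := by
  ext x
  simp [along, constFn]

lemma contDiff_iterBracket {f g : E → E} (hf : ContDiff ℝ ∞ f) (hg : ContDiff ℝ ∞ g) (i : ℕ) :
    ContDiff ℝ ∞ (iterBracket f g i) := by
  induction i with
  | zero => exact hf
  | succ i ih =>
    rw [iterBracket, Function.iterate_succ_apply']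
    exact contDiff_lieBracket ih hg

lemma iterBracket_succ (f g : E → E) (i : ℕ) :
    iterBracket f g (i + 1) = VectorField.lieBracket ℝ (iterBracket f g i) g :=
  Function.iterate_succ_apply' _ _ _

/-- The derivation along `[[…[f, g], …], g]`, with `i` copies of `g`. -/
noncomputable def bracketD {f g : E → E} (hf : ContDiff ℝ ∞ f) (hg : ContDiff ℝ ∞ g) (i : ℕ) :
    Module.End ℝ (smoothFunctions E) :=
  lieD (contDiff_iterBracket hf hg i)

lemma bracketD_zero {f g : E → E} (hf : ContDiff ℝ ∞ f) (hg : ContDiff ℝ ∞ g) :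
    bracketD hf hg 0 = lieD hf := rfl

lemma bracketD_succ {f g : E → E} (hf : ContDiff ℝ ∞ f) (hg : ContDiff ℝ ∞ g) (i : ℕ) :
    bracketD hf hg (i + 1) = bracketD hf hg i * lieD hg - lieD hg * bracketD hf hg i := by
  rw [bracketD, bracketD, ← lieD_lieBracket (contDiff_iterBracket hf hg i) hg]
  ext W x
  simp [iterBracket_succ]

end Operators

/-! ### Iterated commutators -/

section Ring

variable {A : Type*} [Ring A]

/-- Moving a power of `G` from the right of `B i` to its left produces iterated commutators. -/
lemma mul_pow_eq_sum_commutator {B : ℕ → A} {G : A}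
    (hB : ∀ i, B (i + 1) = B i * G - G * B i) (i k : ℕ) :
    B i * G ^ k = ∑ p ∈ Finset.HasAntidiagonal.antidiagonal k,
      k.choose p.1 • (G ^ p.2 * B (i + p.1)) := by
  induction k generalizing i with
  | zero => simp
  | succ k ih =>
    have h1 : B i * G = G * B i + B (i + 1) := by rw [hB]; abel
    rw [pow_succ', ← mul_assoc, h1, add_mul, mul_assoc, ih i, ih (i + 1),
      Finset.sum_antidiagonal_choose_succ_nsmul (fun a b => G ^ b * B (i + a)), Finset.mul_sum]
    congr 1
    · refine Finset.sum_congr rfl fun p _ => ?_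
      rw [mul_smul_comm, pow_succ', mul_assoc]
    · refine Finset.sum_congr rfl fun p hp => ?_
      rw [add_right_comm, add_assoc,
        Nat.choose_symm_of_eq_add (Finset.HasAntidiagonal.mem_antidiagonal.1 hp).symm]

/-- The binomial formula for iterated commutators. -/
lemma commutator_eq_sum {B : ℕ → A} {G : A} (hB : ∀ i, B (i + 1) = B i * G - G * B i) (k : ℕ) :
    B k = ∑ p ∈ Finset.HasAntidiagonal.antidiagonal k,
      k.choose p.1 • ((-1 : ℤ) ^ p.1 • (G ^ p.1 * B 0 * G ^ p.2)) := by
  induction k with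
  | zero => simp
  | succ k ih =>
    rw [hB, Finset.sum_antidiagonal_choose_succ_nsmul
      (fun a b => (-1 : ℤ) ^ a • (G ^ a * B 0 * G ^ b)),
      ih, Finset.mul_sum, Finset.sum_mul, sub_eq_add_neg, ← Finset.sum_neg_distrib]
    congr 1
    · refine Finset.sum_congr rfl fun p _ => ?_
      rw [smul_mul_assoc, smul_mul_assoc, pow_succ G, mul_assoc _ _ G]
    · refine Finset.sum_congr rfl fun p hp => ?_
      rw [Nat.choose_symm_of_eq_add (Finset.HasAntidiagonal.mem_antidiagonal.1 hp).symm,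
        mul_smul_comm, mul_smul_comm, pow_succ' G, pow_succ, mul_smul, ← smul_neg, ← smul_neg]
      simp [mul_assoc]

/-- Iterated commutators of `G` with `F`, in terms of the commutator of `F` with `G`. -/
lemma commutator_succ_eq_sum {C : ℕ → A} {F Z : A} (hC : ∀ i, C (i + 1) = C i * F - F * C i)
    (hZ : Z = F * C 0 - C 0 * F) (k : ℕ) :
    C (k + 1) = ∑ p ∈ Finset.HasAntidiagonal.antidiagonal k,
      k.choose p.1 • ((-1 : ℤ) ^ (p.1 + 1) • (F ^ p.1 * Z * F ^ p.2)) := by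
  rw [commutator_eq_sum (B := fun i => C (i + 1)) (fun i => hC (i + 1)) k]
  refine Finset.sum_congr rfl fun p _ => ?_
  have h : C (0 + 1) = -Z := by rw [hC, hZ, neg_sub]
  rw [h, pow_succ, mul_smul]
  simp

end Ring

/-! ### Orders in the scaling parameter -/

section Order

/-- Pairs `(h, s)` of a scaling parameter `h → 0⁺` and a rescaled time `s ∈ [0, 1]`. -/
abbrev scaleFilter : Filter (ℝ × ℝ) := 𝓝[>] 0 ×ˢ 𝓟 (Icc 0 1)

/-- `φ(h, s) = O(h^q)` as `h → 0⁺`, uniformly in `s ∈ [0, 1]`. -/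
def IsOrder (φ : ℝ × ℝ → ℝ) (q : ℕ) : Prop := φ =O[scaleFilter] fun p => p.1 ^ q

variable {φ ψ φ' : ℝ × ℝ → ℝ} {q r : ℕ}

lemma eventually_scaleFilter : ∀ᶠ p in scaleFilter, p.1 ∈ Ioc (0 : ℝ) 1 ∧ p.2 ∈ Icc (0 : ℝ) 1 := by
  rw [eventually_prod_principal_iff]
  filter_upwards [Ioc_mem_nhdsGT (zero_lt_one (α := ℝ))] with h hh s hs using ⟨hh, hs⟩

lemma IsOrder.mono (h : IsOrder φ q) (hr : r ≤ q) : IsOrder φ r := by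
  refine Asymptotics.IsBigO.trans h (Asymptotics.IsBigO.of_bound 1 ?_)
  filter_upwards [eventually_scaleFilter] with p hp
  rw [one_mul, norm_pow, norm_pow, Real.norm_of_nonneg hp.1.1.le]
  exact pow_le_pow_of_le_one hp.1.1.le hp.1.2 hr

lemma IsOrder.add (h₁ : IsOrder φ q) (h₂ : IsOrder ψ q) : IsOrder (fun p => φ p + ψ p) q :=
  Asymptotics.IsBigO.add h₁ h₂

lemma IsOrder.sub (h₁ : IsOrder φ q) (h₂ : IsOrder ψ q) : IsOrder (fun p => φ p - ψ p) q :=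
  Asymptotics.IsBigO.sub h₁ h₂

lemma IsOrder.mul (h₁ : IsOrder φ q) (h₂ : IsOrder ψ r) :
    IsOrder (fun p => φ p * ψ p) (q + r) := by
  simpa only [IsOrder, pow_add] using Asymptotics.IsBigO.mul h₁ h₂

lemma IsOrder.pow (h : IsOrder φ q) (k : ℕ) : IsOrder (fun p => φ p ^ k) (q * k) := by
  simpa only [IsOrder, pow_mul] using Asymptotics.IsBigO.pow h k

lemma IsOrder.const_mul (h : IsOrder φ q) (c : ℝ) : IsOrder (fun p => c * φ p) q :=
  Asymptotics.IsBigO.const_mul_left h c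

lemma IsOrder.div_const (h : IsOrder φ q) (c : ℝ) : IsOrder (fun p => φ p / c) q := by
  simpa only [div_eq_inv_mul] using h.const_mul c⁻¹

lemma IsOrder.sum {ι : Type*} {s : Finset ι} {φ : ι → ℝ × ℝ → ℝ}
    (h : ∀ i ∈ s, IsOrder (φ i) q) : IsOrder (fun p => ∑ i ∈ s, φ i p) q :=
  Asymptotics.IsBigO.fun_sum h

lemma isOrder_fst_pow (q : ℕ) : IsOrder (fun p => p.1 ^ q) q := Asymptotics.isBigO_refl _ _

lemma isOrder_snd {w : ℝ → ℝ} (hw : Continuous w) : IsOrder (fun p => w p.2) 0 := by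
  obtain ⟨C, hC⟩ := isCompact_Icc.exists_bound_of_continuousOn (s := Icc (0 : ℝ) 1)
    hw.continuousOn
  refine Asymptotics.IsBigO.of_bound C ?_
  filter_upwards [eventually_scaleFilter] with p hp
  simpa using hC p.2 hp.2

lemma IsOrder.congr (h : IsOrder φ q) (he : ∀ p, φ p = ψ p) : IsOrder ψ q := by
  rwa [← funext he]

lemma IsOrder.exists_bound (h : IsOrder φ q) :
    ∃ C, ∀ᶠ r in 𝓝[>] (0 : ℝ), ∀ s ∈ Icc (0 : ℝ) 1, |φ (r, s)| ≤ C * r ^ q := by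
  obtain ⟨C, hC⟩ := Asymptotics.IsBigO.bound h
  refine ⟨C, ?_⟩
  rw [eventually_prod_principal_iff] at hC
  filter_upwards [hC, self_mem_nhdsWithin] with r hr (hr0 : 0 < r) s hs
  simpa [abs_of_pos hr0] using hr s hs

/-- A function of `s` starting at zero inherits the order of its derivative. -/
lemma IsOrder.of_hasDerivWithinAt (hφ' : IsOrder φ' q)
    (h : ∀ᶠ r in 𝓝[>] (0 : ℝ), φ (r, 0) = 0 ∧ ∀ s ∈ Icc (0 : ℝ) 1,
      HasDerivWithinAt (fun s => φ (r, s)) (φ' (r, s)) (Icc 0 1) s) : IsOrder φ q := by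
  obtain ⟨C, hC⟩ := hφ'.exists_bound
  refine Asymptotics.IsBigO.of_bound C ?_
  rw [eventually_prod_principal_iff]
  filter_upwards [hC, h, self_mem_nhdsWithin] with r hr h (hr0 : 0 < r) s hs
  have := (convex_Icc (0 : ℝ) 1).norm_image_sub_le_of_norm_hasDerivWithin_le h.2 hr
    (left_mem_Icc.2 zero_le_one) hs
  simp only [h.1, sub_zero, Real.norm_eq_abs] at this
  have h0 : 0 ≤ C * r ^ q := (abs_nonneg _).trans (hr 0 (left_mem_Icc.2 zero_le_one))
  simp only [Real.norm_eq_abs, abs_pow, abs_of_pos hr0]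
  calc _ ≤ C * r ^ q * |s| := this
    _ ≤ C * r ^ q * 1 := by
      gcongr
      exact abs_le.2 ⟨by linarith [hs.1], hs.2⟩
    _ = _ := mul_one _

/-- The sign of the leading coefficient decides the sign for small values of the parameter. -/
lemma IsOrder.eventually_neg {P : ℝ → ℝ} (h : IsOrder (fun p => φ p - p.1 ^ q * P p.2) (q + 1))
    (hP : P 1 < 0) : ∀ᶠ r in 𝓝[>] (0 : ℝ), φ (r, 1) < 0 := by
  obtain ⟨C, hC⟩ := h.exists_bound
  have ht : Tendsto (fun r : ℝ => P 1 + C * r) (𝓝[>] 0) (𝓝 (P 1 + C * 0)) :=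
    (Continuous.tendsto (by fun_prop) 0).mono_left nhdsWithin_le_nhds
  have := ht.eventually_lt_const (u := 0) (by simpa using hP)
  filter_upwards [hC, this, self_mem_nhdsWithin] with r hr h1 (hr0 : 0 < r)
  have h2 := (abs_le.1 (hr 1 (right_mem_Icc.2 zero_le_one))).2
  have h3 : r ^ q * (P 1 + C * r) < 0 := mul_neg_of_pos_of_neg (by positivity) h1
  have : C * r ^ (q + 1) = r ^ q * (C * r) := by ring
  nlinarith

end Order

/-! ### Expansion of smooth functions along rescaled trajectories -/

section Expansion

variable {E : Type*} [NormedAddCommGroup E] [NormedSpace ℝ E]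

/-- A family of trajectories, on the time intervals `[0, h²]` and in rescaled time `s = t / h²`,
for the controls `-h^(b-2) w'(t / h²)`, whose primitives are `-h^b w(t / h²)`. The case `b = 1` is
that of controls of size `h⁻¹`, the case `b = 3` that of controls of size `h`. -/
structure IsScaledFamily (f g : E → E) (x₀ : E) (a : ℝ) (b : ℕ) (w w' : ℝ → ℝ)
    (z : ℝ → ℝ → E) : Prop where
  initial : ∀ᶠ h in 𝓝[>] (0 : ℝ), z h 0 = x₀
  mem : ∀ᶠ h in 𝓝[>] (0 : ℝ), ∀ s ∈ Icc (0 : ℝ) 1, z h s ∈ Metric.closedBall x₀ a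
  deriv : ∀ᶠ h in 𝓝[>] (0 : ℝ), ∀ s ∈ Icc (0 : ℝ) 1, HasDerivWithinAt (z h)
    (h ^ 2 • f (z h s) - (h ^ b * w' s) • g (z h s)) (Icc 0 1) s

variable {f g : E → E} {hf : ContDiff ℝ ∞ f} {hg : ContDiff ℝ ∞ g}
  {x₀ : E} {a : ℝ} {b : ℕ} {w w' : ℝ → ℝ} {z : ℝ → ℝ → E}

/-- The value at `(h, s)` of the `R`-th Taylor polynomial of `W` along the flow of `g`, for the
flow time `h^b w(s)` and the base point `z h s`. The flow of `g` undoes the action of the control,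
so that only the iterated brackets of `f` with `g` drive this quantity. -/
noncomputable def transported (hg : ContDiff ℝ ∞ g) (b : ℕ) (w : ℝ → ℝ) (z : ℝ → ℝ → E) (R : ℕ)
    (W : smoothFunctions E) (p : ℝ × ℝ) : ℝ :=
  ∑ k ∈ Finset.range (R + 1),
    (p.1 ^ b * w p.2) ^ k / k.factorial * ((lieD hg ^ k) W).1 (z p.1 p.2)

lemma transported_sub (R : ℕ) (W₁ W₂ : smoothFunctions E) (p : ℝ × ℝ) :
    transported hg b w z R (W₁ - W₂) p =
      transported hg b w z R W₁ p - transported hg b w z R W₂ p := by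
  simp [transported, map_sub, mul_sub]

lemma transported_constFn (R : ℕ) (c : ℝ) (p : ℝ × ℝ) :
    transported hg b w z R (constFn c) p = c := by
  rw [transported, Finset.sum_range_succ', Finset.sum_eq_zero]
  · simp
  · intro k _
    rw [pow_succ (lieD hg), Module.End.mul_apply, lieD_constFn, map_zero]
    simp

lemma transported_of_eq_zero (R : ℕ) (W : smoothFunctions E) {h s : ℝ} (hs : w s = 0) :
    transported hg b w z R W (h, s) = W.1 (z h s) := by
  rw [transported, Finset.sum_range_succ', Finset.sum_eq_zero] <;> simp [hs]

lemma isOrder_apply [ProperSpace E] (hz : IsScaledFamily f g x₀ a b w w' z)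
    (W : smoothFunctions E) : IsOrder (fun p => W.1 (z p.1 p.2)) 0 := by
  obtain ⟨C, hC⟩ := (isCompact_closedBall x₀ a).exists_bound_of_continuousOn
    (contDiff_coe W).continuous.continuousOn
  refine Asymptotics.IsBigO.of_bound C ?_
  rw [eventually_prod_principal_iff]
  filter_upwards [hz.mem] with h hh s hs
  simpa using hC _ (hh s hs)

lemma isOrder_scaled (b : ℕ) (hw : Continuous w) : IsOrder (fun p => p.1 ^ b * w p.2) b :=
  (isOrder_fst_pow b).mul (isOrder_snd hw)

lemma isOrder_scaled_pow (hw : Continuous w) (k : ℕ) :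
    IsOrder (fun p => (p.1 ^ b * w p.2) ^ k / k.factorial) (b * k) :=
  ((isOrder_scaled b hw).pow k).div_const _

lemma isOrder_transported [ProperSpace E] (hz : IsScaledFamily f g x₀ a b w w' z)
    (hw : Continuous w) (R : ℕ) (W : smoothFunctions E) :
    IsOrder (transported hg b w z R W) 0 :=
  IsOrder.sum fun k _ =>
    (((isOrder_scaled_pow (b := b) hw k).mono (Nat.zero_le _)).mul (isOrder_apply hz _) :
      IsOrder _ (0 + 0))

lemma hasDerivWithinAt_apply {y : ℝ → E} {y' : E} {S : Set ℝ} {s : ℝ}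
    (hy : HasDerivWithinAt y y' S s) (W : smoothFunctions E) :
    HasDerivWithinAt (fun s => W.1 (y s)) (fderiv ℝ W.1 (y s) y') S s :=
  (((contDiff_coe W).differentiable (by simp)) (y s)).hasFDerivAt.comp_hasDerivWithinAt s hy

/-- The terms produced by the control cancel, except for the last one. -/
lemma hasDerivWithinAt_transported (hf : ContDiff ℝ ∞ f) {h s : ℝ}
    (hw : ∀ s, HasDerivAt w (w' s) s)
    (hz : HasDerivWithinAt (z h) (h ^ 2 • f (z h s) - (h ^ b * w' s) • g (z h s)) (Icc 0 1) s)
    (R : ℕ) (W : smoothFunctions E) :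
    HasDerivWithinAt (fun s => transported hg b w z R W (h, s))
      (h ^ 2 * (∑ k ∈ Finset.range (R + 1), (h ^ b * w s) ^ k / k.factorial *
          (lieD hf ((lieD hg ^ k) W)).1 (z h s)) -
        (h ^ b * w s) ^ R / R.factorial * (h ^ b * w' s) * ((lieD hg ^ (R + 1)) W).1 (z h s))
      (Icc 0 1) s := by
  have key : ∀ U : smoothFunctions E, HasDerivWithinAt (fun s => U.1 (z h s))
      (h ^ 2 * (lieD hf U).1 (z h s) - (h ^ b * w' s) * (lieD hg U).1 (z h s)) (Icc 0 1) s := by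
    intro U
    have := hasDerivWithinAt_apply hz U
    rw [map_sub, map_smul, map_smul] at this
    exact this
  induction R with
  | zero =>
    have := key W
    simpa [transported] using this
  | succ R ih =>
    have h1 : HasDerivWithinAt (fun s => (h ^ b * w s) ^ (R + 1) / ((R + 1).factorial : ℝ))
        ((h ^ b * w s) ^ R / R.factorial * (h ^ b * w' s)) (Icc 0 1) s := by
      have := ((((hw s).const_mul (h ^ b)).pow (R + 1)).div_const
        ((R + 1).factorial : ℝ)).hasDerivWithinAt (s := Icc 0 1)
      refine this.congr_deriv ?_
      rw [Nat.factorial_succ]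
      push_cast
      have : (R.factorial : ℝ) ≠ 0 := by positivity
      field_simp
    have h2 := ih.add (h1.mul (key ((lieD hg ^ (R + 1)) W)))
    have h3 : (fun s => transported hg b w z (R + 1) W (h, s)) =
        (fun s => transported hg b w z R W (h, s)) + (fun s =>
          (h ^ b * w s) ^ (R + 1) / ((R + 1).factorial : ℝ)) *
            fun s => ((lieD hg ^ (R + 1)) W).1 (z h s) := by
      ext s
      simp only [transported, Pi.add_apply, Pi.mul_apply]
      rw [Finset.sum_range_succ _ (R + 1)]
    rw [h3]
    refine h2.congr_deriv ?_
    rw [Finset.sum_range_succ _ (R + 1), pow_succ' (lieD hg) (R + 1), Module.End.mul_apply]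
    ring

/-- A sum over a square is the sum over its lower left triangle and the remaining half. -/
lemma sum_square_eq_sum_antidiagonal_add (F : ℕ × ℕ → ℝ) (R : ℕ) :
    ∑ q ∈ Finset.range (R + 1) ×ˢ Finset.range (R + 1), F q =
      ∑ k ∈ Finset.range (R + 1), ∑ q ∈ Finset.HasAntidiagonal.antidiagonal k, F q +
      ∑ q ∈ (Finset.range (R + 1) ×ˢ Finset.range (R + 1)).filter
        (fun q => R + 1 ≤ q.1 + q.2), F q := by
  rw [← Finset.sum_filter_not_add_sum_filter _ (fun q : ℕ × ℕ => R + 1 ≤ q.1 + q.2)]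
  congr 1
  rw [← Finset.sum_fiberwise_of_maps_to (t := Finset.range (R + 1)) (g := fun q => q.1 + q.2)]
  · refine Finset.sum_congr rfl fun k hk => Finset.sum_congr ?_ fun _ _ => rfl
    ext q
    simp only [Finset.mem_filter, Finset.mem_product, Finset.mem_range,
      Finset.HasAntidiagonal.mem_antidiagonal] at hk ⊢
    lia
  · intro q hq
    simp only [Finset.mem_filter, Finset.mem_range] at hq ⊢
    lia

/-- Commuting `f` to the right of the powers of `g` in a truncated Taylor expansion. -/
lemma sum_pow_eq_sum_bracketD (v : ℝ) (R : ℕ) (W : smoothFunctions E) (y : E) :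
    ∑ k ∈ Finset.range (R + 1), v ^ k / k.factorial * (lieD hf ((lieD hg ^ k) W)).1 y =
      ∑ k ∈ Finset.range (R + 1), ∑ p ∈ Finset.HasAntidiagonal.antidiagonal k,
        v ^ p.1 / p.1.factorial * (v ^ p.2 / p.2.factorial *
          ((lieD hg ^ p.2) (bracketD hf hg p.1 W)).1 y) := by
  refine Finset.sum_congr rfl fun k _ => ?_
  have h1 := mul_pow_eq_sum_commutator (B := bracketD hf hg) (G := lieD hg)
    (bracketD_succ hf hg) 0 k
  have h2 := congrArg (fun T : Module.End ℝ (smoothFunctions E) => (T W).1 y) h1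
  simp only [bracketD_zero, Module.End.mul_apply, zero_add, LinearMap.sum_apply,
    LinearMap.smul_apply] at h2
  rw [h2, AddSubmonoidClass.coe_finsetSum, Finset.sum_apply, Finset.mul_sum]
  refine Finset.sum_congr rfl fun p hp => ?_
  have hp' : p.1 + p.2 = k := Finset.HasAntidiagonal.mem_antidiagonal.1 hp
  subst hp'
  have h3 : ((p.1 + p.2).factorial : ℝ) =
      (p.1 + p.2).choose p.1 * (p.1.factorial * p.2.factorial) := by
    rw [← mul_assoc, Nat.choose_symm_add]
    exact_mod_cast (Nat.add_choose_mul_factorial_mul_factorial p.1 p.2).symm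
  have h4 : ((p.1 + p.2).choose p.1 : ℝ) ≠ 0 := by
    exact_mod_cast (Nat.choose_pos (Nat.le_add_right _ _)).ne'
  rw [h3, pow_add]
  have h5 : (p.1.factorial : ℝ) ≠ 0 := by positivity
  have h6 : (p.2.factorial : ℝ) ≠ 0 := by positivity
  simp only [SetLike.val_smul_of_tower, Pi.smul_apply, nsmul_eq_mul]
  field_simp

/-- The derivative of a transported function is, up to a remainder of order `R + 1`, the
combination of the transported bracket derivatives. -/
lemma exists_hasDerivWithinAt_transported [ProperSpace E] (hf : ContDiff ℝ ∞ f)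
    (hg : ContDiff ℝ ∞ g) (hz : IsScaledFamily f g x₀ a b w w' z)
    (hb : 1 ≤ b) (hw : ∀ s, HasDerivAt w (w' s) s) (hw' : Continuous w')
    (R : ℕ) (W : smoothFunctions E) :
    ∃ e : ℝ × ℝ → ℝ, IsOrder e (R + 1) ∧ ∀ᶠ h in 𝓝[>] (0 : ℝ), ∀ s ∈ Icc (0 : ℝ) 1,
      HasDerivWithinAt (fun s => transported hg b w z R W (h, s))
        (h ^ 2 * (∑ i ∈ Finset.range (R + 1), (h ^ b * w s) ^ i / i.factorial *
          transported hg b w z R (bracketD hf hg i W) (h, s)) + e (h, s)) (Icc 0 1) s := by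
  have hwc : Continuous w := continuous_iff_continuousAt.2 fun s => (hw s).continuousAt
  refine ⟨fun p => p.1 ^ 2 * (∑ k ∈ Finset.range (R + 1), (p.1 ^ b * w p.2) ^ k / k.factorial *
          (lieD hf ((lieD hg ^ k) W)).1 (z p.1 p.2)) -
        (p.1 ^ b * w p.2) ^ R / R.factorial * (p.1 ^ b * w' p.2) *
          ((lieD hg ^ (R + 1)) W).1 (z p.1 p.2) -
        p.1 ^ 2 * (∑ i ∈ Finset.range (R + 1), (p.1 ^ b * w p.2) ^ i / i.factorial *
          transported hg b w z R (bracketD hf hg i W) p), ?_, ?_⟩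
  · have h1 : IsOrder (fun p => (p.1 ^ b * w p.2) ^ R / R.factorial * (p.1 ^ b * w' p.2) *
          ((lieD hg ^ (R + 1)) W).1 (z p.1 p.2)) (R + 1) := by
      refine (((isOrder_scaled_pow (b := b) hwc R).mul (isOrder_scaled b hw')).mul
        (isOrder_apply hz _)).mono ?_
      nlinarith
    have h2 : IsOrder (fun p => p.1 ^ 2 *
        ∑ q ∈ (Finset.range (R + 1) ×ˢ Finset.range (R + 1)).filter
        (fun q => R + 1 ≤ q.1 + q.2), (p.1 ^ b * w p.2) ^ q.1 / q.1.factorial *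
          ((p.1 ^ b * w p.2) ^ q.2 / q.2.factorial *
          ((lieD hg ^ q.2) (bracketD hf hg q.1 W)).1 (z p.1 p.2))) (R + 1) := by
      refine ((isOrder_fst_pow 2).mul (IsOrder.sum (q := R + 1) fun q hq => ?_)).mono (by lia)
      refine ((isOrder_scaled_pow (b := b) hwc q.1).mul
        ((isOrder_scaled_pow (b := b) hwc q.2).mul (isOrder_apply hz _))).mono ?_
      have := (Finset.mem_filter.1 hq).2
      nlinarith
    refine ((h1.const_mul (-1)).sub h2).congr fun p => ?_
    rw [sum_pow_eq_sum_bracketD]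
    have h3 := sum_square_eq_sum_antidiagonal_add (fun q => (p.1 ^ b * w p.2) ^ q.1 /
      q.1.factorial * ((p.1 ^ b * w p.2) ^ q.2 / q.2.factorial *
        ((lieD hg ^ q.2) (bracketD hf hg q.1 W)).1 (z p.1 p.2))) R
    rw [Finset.sum_product] at h3
    simp only [transported, Finset.mul_sum (Finset.range (R + 1)) _ (_ / _), h3]
    ring
  · filter_upwards [hz.deriv] with h hh s hs
    refine (hasDerivWithinAt_transported hf hw (hh s hs) R W).congr_deriv ?_
    ring

end Expansion

/-! ### Vanishing orders and leading terms -/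

section Vanishing

variable {E : Type*} [NormedAddCommGroup E] [NormedSpace ℝ E] {f g : E → E}
  {hf : ContDiff ℝ ∞ f} {hg : ContDiff ℝ ∞ g} {x₀ : E} {m : ℕ} {W : smoothFunctions E}

/-- The composition of the bracket derivations whose numbers of copies of `g` are listed in `J`. -/
noncomputable def wordD (hf : ContDiff ℝ ∞ f) (hg : ContDiff ℝ ∞ g) (J : List ℕ) :
    Module.End ℝ (smoothFunctions E) :=
  (J.map (bracketD hf hg)).prod

/-- All words of total order less than `m` in the brackets `[[…[f, g], …], g]` annihilate `W` at
`x₀`; the order of a bracket is the number of vector fields in it. The empty word counts, so that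
`W` itself vanishes at `x₀` as soon as `0 < m`. -/
def VanishesBelow (hf : ContDiff ℝ ∞ f) (hg : ContDiff ℝ ∞ g) (x₀ : E) (m : ℕ)
    (W : smoothFunctions E) : Prop :=
  ∀ J : List ℕ, (J.map (· + 1)).sum < m → (wordD hf hg J W).1 x₀ = 0

lemma wordD_append_singleton (J : List ℕ) (i : ℕ) (W : smoothFunctions E) :
    wordD hf hg (J ++ [i]) W = wordD hf hg J (bracketD hf hg i W) := by
  simp [wordD]

lemma VanishesBelow.bracketD (h : VanishesBelow hf hg x₀ m W) (i : ℕ) :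
    VanishesBelow hf hg x₀ (m - (i + 1)) (bracketD hf hg i W) := by
  intro J hJ
  rw [← wordD_append_singleton]
  refine h _ ?_
  rw [List.map_append, List.sum_append]
  simp only [List.map_cons, List.map_nil, List.sum_singleton]
  lia

lemma VanishesBelow.lieD (h : VanishesBelow hf hg x₀ m W) :
    VanishesBelow hf hg x₀ (m - 1) (lieD hf W) :=
  h.bracketD 0

lemma VanishesBelow.lieD_pow (h : VanishesBelow hf hg x₀ m W) (j : ℕ) :
    VanishesBelow hf hg x₀ (m - j) ((SampledData.lieD hf ^ j) W) := by
  induction j with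
  | zero => simpa using h
  | succ j ih =>
    rw [pow_succ', Module.End.mul_apply, Nat.sub_add_eq]
    exact ih.lieD

lemma VanishesBelow.apply_eq_zero (h : VanishesBelow hf hg x₀ m W) (hm : 0 < m) :
    W.1 x₀ = 0 := by
  simpa [wordD] using h [] (by simpa using hm)

lemma vanishesBelow_one (h : W.1 x₀ = 0) : VanishesBelow hf hg x₀ 1 W := by
  intro J hJ
  cases J with
  | nil => simpa [wordD] using h
  | cons i J => simp at hJ

lemma vanishesBelow_sub_constFn
    (h : ∀ J : List ℕ, J ≠ [] → (J.map (· + 1)).sum < m → (wordD hf hg J W).1 x₀ = 0) :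
    VanishesBelow hf hg x₀ m (W - constFn (W.1 x₀)) := by
  intro J hJ
  rcases List.eq_nil_or_concat' J with rfl | ⟨J', i, rfl⟩
  · simp [wordD]
  · have h1 : wordD hf hg (J' ++ [i]) (constFn (W.1 x₀)) = 0 := by
      rw [wordD_append_singleton, SampledData.bracketD, lieD_constFn, map_zero]
    rw [map_sub, h1, sub_zero]
    exact h _ (by simp) hJ

lemma isOrder_bracket_term {b R r : ℕ} {w : ℝ → ℝ} {z : ℝ → ℝ → E}
    (hwc : Continuous w) (i : ℕ) {U : smoothFunctions E}
    (h : IsOrder (transported hg b w z R U) r) :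
    IsOrder (fun p => p.1 ^ 2 * ((p.1 ^ b * w p.2) ^ i / i.factorial *
      transported hg b w z R U p)) (2 + (b * i + r)) :=
  (isOrder_fst_pow 2).mul ((isOrder_scaled_pow hwc i).mul h)

end Vanishing

section Leading

variable {E : Type*} [NormedAddCommGroup E] [NormedSpace ℝ E] [ProperSpace E] {f g : E → E}
  {hf : ContDiff ℝ ∞ f} {hg : ContDiff ℝ ∞ g}
  {x₀ : E} {a : ℝ} {b : ℕ} {w w' : ℝ → ℝ} {z : ℝ → ℝ → E} {R m q r : ℕ}
  {W : smoothFunctions E}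

/-- A leading term of the transported function is the primitive of a leading term of the bracket
sum in its derivative. -/
lemma isOrder_transported_sub (hf : ContDiff ℝ ∞ f) (hz : IsScaledFamily f g x₀ a b w w' z)
    (hb : 1 ≤ b)
    (hw : ∀ s, HasDerivAt w (w' s) s) (hw' : Continuous w') (hw0 : w 0 = 0)
    {P P' : ℝ → ℝ} (hP : ∀ s, HasDerivAt P (P' s) s) (hP0 : P 0 = 0) (hW : W.1 x₀ = 0)
    (hr : r ≤ R + 1)
    (h : IsOrder (fun p => p.1 ^ 2 * (∑ i ∈ Finset.range (R + 1),
      (p.1 ^ b * w p.2) ^ i / i.factorial * transported hg b w z R (bracketD hf hg i W) p) -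
        p.1 ^ q * P' p.2) r) :
    IsOrder (fun p => transported hg b w z R W p - p.1 ^ q * P p.2) r := by
  obtain ⟨e, he, hd⟩ := exists_hasDerivWithinAt_transported hf hg hz hb hw hw' R W
  refine IsOrder.of_hasDerivWithinAt (h.add (he.mono hr)) ?_
  filter_upwards [hd, hz.initial] with h hd h0
  refine ⟨?_, fun s hs => ?_⟩
  · simp [transported_of_eq_zero R W hw0, h0, hW, hP0]
  · refine ((hd s hs).sub ((hP s).const_mul (h ^ q)).hasDerivWithinAt).congr_deriv ?_
    ring

/-- For a control of size `h⁻¹`: each letter of a word contributes at least its order, and one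
letter contributes one more. -/
lemma VanishesBelow.isOrder_transported_one (h : VanishesBelow hf hg x₀ m W)
    (hz : IsScaledFamily f g x₀ a 1 w w' z)
    (hw : ∀ s, HasDerivAt w (w' s) s) (hw' : Continuous w') (hw0 : w 0 = 0)
    (hm : 1 ≤ m) (hR : m ≤ R) : IsOrder (transported hg 1 w z R W) (m + 1) := by
  have hwc : Continuous w := continuous_iff_continuousAt.2 fun s => (hw s).continuousAt
  induction m using Nat.strong_induction_on generalizing W with
  | _ m ih =>
  have := isOrder_transported_sub (q := 0) (P := fun _ => 0) (P' := fun _ => 0) (R := R) hf hz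
    le_rfl hw hw' hw0 (hg := hg) (fun s => hasDerivAt_const s 0) rfl (h.apply_eq_zero hm)
    (r := m + 1) (by lia) ?_
  · simpa using this
  refine IsOrder.congr (φ := fun p => ∑ i ∈ Finset.range (R + 1), p.1 ^ 2 *
    ((p.1 ^ 1 * w p.2) ^ i / i.factorial *
      transported hg 1 w z R (SampledData.bracketD hf hg i W) p)) (IsOrder.sum fun i _ => ?_)
    fun p => by rw [Finset.mul_sum]; ring
  by_cases hi : i + 1 < m
  · exact (isOrder_bracket_term hwc i
      (ih (m - (i + 1)) (by lia) (h.bracketD i) (by lia) (by lia))).mono (by lia)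
  · exact (isOrder_bracket_term hwc i (isOrder_transported hz hwc R _)).mono (by lia)

/-- For a control of size `h`: each letter of a word contributes at least twice its order. -/
lemma VanishesBelow.isOrder_transported_three (h : VanishesBelow hf hg x₀ m W)
    (hz : IsScaledFamily f g x₀ a 3 w w' z)
    (hw : ∀ s, HasDerivAt w (w' s) s) (hw' : Continuous w') (hw0 : w 0 = 0)
    (hR : 2 * m ≤ R + 1) : IsOrder (transported hg 3 w z R W) (2 * m) := by
  have hwc : Continuous w := continuous_iff_continuousAt.2 fun s => (hw s).continuousAt
  induction m using Nat.strong_induction_on generalizing W with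
  | _ m ih =>
  rcases Nat.eq_zero_or_pos m with rfl | hm
  · exact isOrder_transported hz hwc R _
  have := isOrder_transported_sub (q := 0) (P := fun _ => 0) (P' := fun _ => 0) (R := R) hf hz
    (by lia) hw hw' hw0 (hg := hg) (fun s => hasDerivAt_const s 0) rfl (h.apply_eq_zero hm)
    (r := 2 * m) (by lia) ?_
  · simpa using this
  refine IsOrder.congr (φ := fun p => ∑ i ∈ Finset.range (R + 1), p.1 ^ 2 *
    ((p.1 ^ 3 * w p.2) ^ i / i.factorial *
      transported hg 3 w z R (SampledData.bracketD hf hg i W) p)) (IsOrder.sum fun i _ => ?_)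
    fun p => by rw [Finset.mul_sum]; ring
  exact (isOrder_bracket_term hwc i
    (ih (m - (i + 1)) (by lia) (h.bracketD i) (by lia))).mono (by lia)

/-- For a control of size `h⁻¹` the single bracket with `N` copies of `g` dominates. -/
lemma isOrder_transported_sub_bracket {N : ℕ}
    (h : VanishesBelow hf hg x₀ (N + 1) W) (hz : IsScaledFamily f g x₀ a 1 w w' z)
    (hw : ∀ s, HasDerivAt w (w' s) s) (hw' : Continuous w') (hw0 : w 0 = 0)
    {P : ℝ → ℝ} (hP : ∀ s, HasDerivAt P (w s ^ N) s) (hP0 : P 0 = 0) :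
    IsOrder (fun p => transported hg 1 w z (N + 2) W p - p.1 ^ (N + 2) *
      ((bracketD hf hg N W).1 x₀ / N.factorial * P p.2)) (N + 3) := by
  have hwc : Continuous w := continuous_iff_continuousAt.2 fun s => (hw s).continuousAt
  set c := (bracketD hf hg N W).1 x₀ with hc
  refine isOrder_transported_sub hf hz le_rfl hw hw' hw0
    (P := fun s => c / N.factorial * P s) (P' := fun s => c / N.factorial * w s ^ N)
    (fun s => (hP s).const_mul _) (by simp [hP0]) (h.apply_eq_zero (by lia)) le_rfl ?_
  have hmem : N ∈ Finset.range (N + 2 + 1) := by simp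
  have hlead : IsOrder (fun p => p.1 ^ 2 * ((p.1 ^ 1 * w p.2) ^ N / N.factorial *
      transported hg 1 w z (N + 2) (bracketD hf hg N W - constFn c) p)) (N + 3) := by
    refine (isOrder_bracket_term hwc N (r := 1) ?_).mono (by lia)
    refine IsOrder.mono (q := 2) ?_ (by lia)
    exact (vanishesBelow_one (by simp [hc])).isOrder_transported_one (hf := hf) hz hw hw' hw0 le_rfl
      (by lia)
  have hrest : IsOrder (fun p => ∑ i ∈ (Finset.range (N + 2 + 1)).erase N, p.1 ^ 2 *
      ((p.1 ^ 1 * w p.2) ^ i / i.factorial *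
        transported hg 1 w z (N + 2) (bracketD hf hg i W) p)) (N + 3) := by
    refine IsOrder.sum fun i hi => ?_
    have hiN := Finset.ne_of_mem_erase hi
    rcases lt_or_gt_of_ne hiN with hlt | hgt
    · exact (isOrder_bracket_term hwc i ((h.bracketD i).isOrder_transported_one hz hw hw' hw0
        (by lia) (by lia))).mono (by lia)
    · exact (isOrder_bracket_term hwc i (isOrder_transported hz hwc _ _)).mono (by lia)
  refine (hrest.add hlead).congr fun p => ?_
  rw [← Finset.sum_erase_add _ _ hmem, mul_add, Finset.mul_sum, transported_sub,
    transported_constFn]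
  ring

/-- For a control of size `h` the power of `f` dominates. -/
lemma VanishesBelow.isOrder_transported_sub_pow (h : VanishesBelow hf hg x₀ m W)
    (hz : IsScaledFamily f g x₀ a 3 w w' z)
    (hw : ∀ s, HasDerivAt w (w' s) s) (hw' : Continuous w') (hw0 : w 0 = 0)
    (hR : 2 * m + 1 ≤ R) :
    IsOrder (fun p => transported hg 3 w z R W p - p.1 ^ (2 * m) *
      (((SampledData.lieD hf ^ m) W).1 x₀ * (p.2 ^ m / m.factorial))) (2 * m + 1) := by
  have hwc : Continuous w := continuous_iff_continuousAt.2 fun s => (hw s).continuousAt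
  induction m generalizing W with
  | zero =>
    have h1 : VanishesBelow hf hg x₀ 1 (W - constFn (W.1 x₀)) := vanishesBelow_one (by simp)
    refine ((h1.isOrder_transported_three (R := R) hz hw hw' hw0 (by lia)).mono
      (by lia)).congr fun p => ?_
    rw [transported_sub, transported_constFn]
    simp
  | succ m ih =>
    set c := ((SampledData.lieD hf ^ (m + 1)) W).1 x₀ with hc
    have hd : ∀ s : ℝ, HasDerivAt (fun s : ℝ => c * (s ^ (m + 1) / (m + 1).factorial))
        (c * (s ^ m / m.factorial)) s := fun s => by
      refine (((hasDerivAt_pow (m + 1) s).div_const _).const_mul c).congr_deriv ?_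
      rw [Nat.factorial_succ]
      push_cast
      have : (m.factorial : ℝ) ≠ 0 := by positivity
      field_simp
    refine isOrder_transported_sub hf hz (by lia) hw hw' hw0 hd (by simp)
      (h.apply_eq_zero (by lia)) (by lia) ?_
    have h0 := ih h.lieD (by lia)
    have hc' : c = ((SampledData.lieD hf ^ m) (SampledData.lieD hf W)).1 x₀ := by
      rw [hc, pow_succ, Module.End.mul_apply]
    have hlead := (isOrder_fst_pow 2).mul h0
    have hrest : IsOrder (fun p => ∑ i ∈ Finset.range R, p.1 ^ 2 *
        ((p.1 ^ 3 * w p.2) ^ (i + 1) / (i + 1).factorial *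
          transported hg 3 w z R (SampledData.bracketD hf hg (i + 1) W) p))
            (2 * (m + 1) + 1) :=
      IsOrder.sum fun i _ => (isOrder_bracket_term hwc (i + 1)
        ((h.bracketD (i + 1)).isOrder_transported_three hz hw hw' hw0 (by lia))).mono (by lia)
    refine ((hlead.mono (by lia)).add hrest).congr fun p => ?_
    rw [Finset.sum_range_succ', mul_add, Finset.mul_sum, ← hc', bracketD_zero]
    simp
    ring

/-- If each `φ j` feeds on the next one, at the rate `c`, the weights `(c (1 - s))^j / j!` cancel
these contributions. -/
lemma hasDerivWithinAt_sum_telescope {φ : ℕ → ℝ → ℝ} {D : ℕ → ℝ} {c s : ℝ} {S : Set ℝ}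
    (M : ℕ)
    (h : ∀ j ≤ M, HasDerivWithinAt (φ j) (c * φ (j + 1) s + D j) S s) :
    HasDerivWithinAt
      (fun s => ∑ j ∈ Finset.range (M + 1), c ^ j * ((1 - s) ^ j / j.factorial) * φ j s)
      (c ^ (M + 1) * ((1 - s) ^ M / M.factorial) * φ (M + 1) s +
        ∑ j ∈ Finset.range (M + 1), c ^ j * ((1 - s) ^ j / j.factorial) * D j) S s := by
  induction M with
  | zero => simpa using h 0 le_rfl
  | succ M ih =>
    have h1 : HasDerivWithinAt (fun s : ℝ => c ^ (M + 1) * ((1 - s) ^ (M + 1) /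
        ((M + 1).factorial : ℝ))) (-(c ^ (M + 1) * ((1 - s) ^ M / M.factorial))) S s := by
      have := (((((hasDerivAt_id s).const_sub 1).pow (M + 1)).div_const
        ((M + 1).factorial : ℝ)).const_mul (c ^ (M + 1))).hasDerivWithinAt (s := S)
      refine this.congr_deriv ?_
      rw [Nat.factorial_succ]
      push_cast
      have : (M.factorial : ℝ) ≠ 0 := by positivity
      simp only [id]
      field_simp
    have h3 : (fun s => ∑ j ∈ Finset.range (M + 1 + 1),
        c ^ j * ((1 - s) ^ j / j.factorial) * φ j s) =
        (fun s => ∑ j ∈ Finset.range (M + 1), c ^ j * ((1 - s) ^ j / j.factorial) * φ j s) +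
        (fun s => c ^ (M + 1) * ((1 - s) ^ (M + 1) / ((M + 1).factorial : ℝ))) *
          φ (M + 1) := by
      ext s
      simp only [Pi.add_apply, Pi.mul_apply]
      rw [Finset.sum_range_succ _ (M + 1)]
    rw [h3]
    refine ((ih fun j hj => h j (by lia)).add (h1.mul (h (M + 1) le_rfl))).congr_deriv ?_
    rw [Finset.sum_range_succ _ (M + 1)]
    ring

end Leading

/-! ### Words with a single bracket -/

section MixedWords

variable {E : Type*} [NormedAddCommGroup E] [NormedSpace ℝ E] {f g : E → E}
  {x₀ : E} {a : ℝ} {w w' : ℝ → ℝ} {z : ℝ → ℝ → E} {N : ℕ} {W : smoothFunctions E}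

/-- The value at `x₀` of `f^i [f, g] f^j W`. -/
noncomputable def mixedCoeff (hf : ContDiff ℝ ∞ f) (hg : ContDiff ℝ ∞ g) (x₀ : E)
    (W : smoothFunctions E) (i j : ℕ) : ℝ :=
  ((lieD hf ^ i) (bracketD hf hg 1 ((lieD hf ^ j) W))).1 x₀

/-- The density against which the primitive of the control is integrated in the contribution of
the words with `M` letters `f` and one letter `[f, g]`. -/
noncomputable def mixedPoly (hf : ContDiff ℝ ∞ f) (hg : ContDiff ℝ ∞ g) (x₀ : E)
    (W : smoothFunctions E) (M : ℕ) : Polynomial ℝ :=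
  ∑ p ∈ Finset.HasAntidiagonal.antidiagonal M,
    Polynomial.C (mixedCoeff hf hg x₀ W p.1 p.2 / (p.1.factorial * p.2.factorial)) *
      (Polynomial.X ^ p.1 * (1 - Polynomial.X) ^ p.2)

lemma coeff_X_pow_mul_one_sub_X_pow (i j : ℕ) :
    (Polynomial.X ^ i * (1 - Polynomial.X) ^ j : Polynomial ℝ).coeff (i + j) = (-1) ^ j := by
  have h1 : (1 - Polynomial.X : Polynomial ℝ) =
      Polynomial.C (-1) * (Polynomial.X - Polynomial.C 1) := by
    simp
  rw [add_comm, Polynomial.coeff_X_pow_mul, h1, mul_pow, ← Polynomial.C_pow,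
    Polynomial.coeff_C_mul]
  have h2 := ((Polynomial.monic_X_sub_C (1 : ℝ)).pow j).coeff_natDegree
  rw [Polynomial.natDegree_pow, Polynomial.natDegree_X_sub_C, mul_one] at h2
  rw [h2, mul_one]

lemma bracketD_succ_eq_sum (hf : ContDiff ℝ ∞ f) (hg : ContDiff ℝ ∞ g) (M : ℕ) :
    bracketD hg hf (M + 1) = ∑ p ∈ Finset.HasAntidiagonal.antidiagonal M,
      M.choose p.1 • ((-1 : ℤ) ^ (p.1 + 1) •
        (lieD hf ^ p.1 * bracketD hf hg 1 * lieD hf ^ p.2)) :=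
  commutator_succ_eq_sum (C := bracketD hg hf) (bracketD_succ hg hf) (bracketD_succ hf hg 0) M

/-- The condition on `[[…[g, f], …], f]` says that the density is not the zero polynomial. -/
lemma coeff_mixedPoly (hf : ContDiff ℝ ∞ f) (hg : ContDiff ℝ ∞ g) (M : ℕ) :
    (mixedPoly hf hg x₀ W M).coeff M =
      (-1) ^ (M + 1) / M.factorial * (bracketD hg hf (M + 1) W).1 x₀ := by
  rw [bracketD_succ_eq_sum hf hg M]
  simp only [mixedPoly, Polynomial.finsetSum_coeff, LinearMap.sum_apply,
    LinearMap.smul_apply, AddSubmonoidClass.coe_finsetSum,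
    Finset.sum_apply, Polynomial.coeff_C_mul, Finset.mul_sum]
  refine Finset.sum_congr rfl fun p hp => ?_
  have hp' : p.1 + p.2 = M := Finset.HasAntidiagonal.mem_antidiagonal.1 hp
  subst hp'
  rw [coeff_X_pow_mul_one_sub_X_pow]
  have e1 : ((lieD hf ^ p.1 * bracketD hf hg 1 * lieD hf ^ p.2) W).1 x₀ =
      mixedCoeff hf hg x₀ W p.1 p.2 := rfl
  have h3 : ((p.1 + p.2).factorial : ℝ) =
      (p.1 + p.2).choose p.1 * (p.1.factorial * p.2.factorial) := by
    rw [← mul_assoc, Nat.choose_symm_add]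
    exact_mod_cast (Nat.add_choose_mul_factorial_mul_factorial p.1 p.2).symm
  have h4 : ((p.1 + p.2).choose p.1 : ℝ) ≠ 0 := by
    exact_mod_cast (Nat.choose_pos (Nat.le_add_right _ _)).ne'
  simp only [SetLike.val_smul_of_tower, Pi.smul_apply, nsmul_eq_mul, zsmul_eq_mul, Pi.mul_apply,
    Pi.intCast_apply]
  rw [e1, h3]
  push_cast
  have h5 : (p.1.factorial : ℝ) ≠ 0 := by positivity
  have h6 : (p.2.factorial : ℝ) ≠ 0 := by positivity
  have h7 : ((-1 : ℝ) ^ p.1) ^ 2 = 1 := by rw [← pow_mul, mul_comm, pow_mul]; simp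
  field_simp
  rw [pow_succ, pow_add]
  linear_combination (-(-1 : ℝ) ^ p.2 * mixedCoeff hf hg x₀ W p.1 p.2) * h7

lemma sum_weights_mul_eq_eval_mixedPoly {hf : ContDiff ℝ ∞ f} {hg : ContDiff ℝ ∞ g} (M : ℕ)
    (h s v : ℝ) :
    ∑ j ∈ Finset.range (M + 1), (h ^ 2) ^ j * ((1 - s) ^ j / j.factorial) *
        (h ^ (2 * (M - j) + 5) * (v * (s ^ (M - j) / (M - j).factorial) *
          mixedCoeff hf hg x₀ W (M - j) j)) =
      h ^ (2 * M + 5) * (v * (mixedPoly hf hg x₀ W M).eval s) := by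
  rw [mixedPoly, Polynomial.eval_finsetSum, Finset.Nat.antidiagonal_eq_map', Finset.sum_map,
    Finset.mul_sum, Finset.mul_sum]
  refine Finset.sum_congr rfl fun j hj => ?_
  have hj' : j ≤ M := Nat.lt_succ_iff.1 (Finset.mem_range.1 hj)
  have e1 : h ^ (2 * M + 5) = (h ^ 2) ^ j * h ^ (2 * (M - j) + 5) := by
    rw [← pow_mul, ← pow_add]
    congr 1
    lia
  rw [e1]
  generalize h ^ (2 * (M - j) + 5) = H
  simp only [Polynomial.eval_mul, Polynomial.eval_C, Polynomial.eval_pow, Polynomial.eval_X,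
    Polynomial.eval_sub, Polynomial.eval_one]
  change _ = (h ^ 2) ^ j * H * (v * (mixedCoeff hf hg x₀ W (M - j) j /
    ((M - j).factorial * j.factorial) * (s ^ (M - j) * (1 - s) ^ j)))
  ring

/-- The part of the derivative of the transported `f^j W` that contains brackets. -/
lemma VanishesBelow.isOrder_sum_bracketD [ProperSpace E] {hf : ContDiff ℝ ∞ f}
    {hg : ContDiff ℝ ∞ g} {m R : ℕ} (h : VanishesBelow hf hg x₀ (m + 2) W)
    (hz : IsScaledFamily f g x₀ a 3 w w' z)
    (hw : ∀ s, HasDerivAt w (w' s) s) (hw' : Continuous w') (hw0 : w 0 = 0)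
    (hR : 2 * m + 5 ≤ R) :
    IsOrder (fun p => ∑ i ∈ Finset.range R, p.1 ^ 2 *
      ((p.1 ^ 3 * w p.2) ^ (i + 1) / (i + 1).factorial *
        transported hg 3 w z R (SampledData.bracketD hf hg (i + 1) W) p) -
      p.1 ^ (2 * m + 5) * (w p.2 * (p.2 ^ m / m.factorial) *
        ((SampledData.lieD hf ^ m) (SampledData.bracketD hf hg 1 W)).1 x₀)) (2 * m + 6) := by
  have hwc : Continuous w := continuous_iff_continuousAt.2 fun s => (hw s).continuousAt
  have h1 := (h.bracketD 1).isOrder_transported_sub_pow (R := R) hz hw hw' hw0 (by lia)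
  have hidx : m + 2 - (1 + 1) = m := by lia
  rw [hidx] at h1
  have h2 := (isOrder_fst_pow 2).mul ((isOrder_scaled 3 hwc).mul h1)
  have h3 : IsOrder (fun p => ∑ i ∈ Finset.range (R - 1), p.1 ^ 2 *
      ((p.1 ^ 3 * w p.2) ^ (i + 1 + 1) / (i + 1 + 1).factorial *
      transported hg 3 w z R (SampledData.bracketD hf hg (i + 1 + 1) W) p)) (2 * m + 6) :=
    IsOrder.sum fun i _ => (isOrder_bracket_term hwc (i + 1 + 1)
      ((h.bracketD (i + 1 + 1)).isOrder_transported_three hz hw hw' hw0 (by lia))).mono (by lia)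
  refine ((h2.mono (by lia)).add h3).congr fun p => ?_
  obtain ⟨R, rfl⟩ : ∃ R', R = R' + 1 := ⟨R - 1, by lia⟩
  rw [Finset.sum_range_succ' _ R]
  simp only [Nat.add_sub_cancel, zero_add, pow_one, Nat.factorial_one, Nat.cast_one, div_one]
  ring

/-- The words in `f` and one `[f, g]`, of total order `M + 2`, give the leading term for a control
of size `h`, when the power `f ^ (M + 2)` annihilates `W` at `x₀`. The weights
`(h² (1 - s))^j / j!` transport `W` to the final time along `f`, so that in the derivative of the
sum only the terms with a bracket survive. The exponent is `2 M + 5`, since the `M + 1` letters are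
integrated over times of length `h²` and the letter `[f, g]` carries the factor `h³ w`. -/
lemma isOrder_telescope_sub [ProperSpace E] {hf : ContDiff ℝ ∞ f} {hg : ContDiff ℝ ∞ g} {M : ℕ}
    (h : VanishesBelow hf hg x₀ (M + 2) W)
    (hpow : ((lieD hf ^ (M + 2)) W).1 x₀ = 0)
    (hz : IsScaledFamily f g x₀ a 3 w w' z)
    (hw : ∀ s, HasDerivAt w (w' s) s) (hw' : Continuous w') (hw0 : w 0 = 0)
    {P : ℝ → ℝ} (hP : ∀ s, HasDerivAt P (w s * (mixedPoly hf hg x₀ W M).eval s) s)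
    (hP0 : P 0 = 0) :
    IsOrder (fun p => ∑ j ∈ Finset.range (M + 1 + 1),
      (p.1 ^ 2) ^ j * ((1 - p.2) ^ j / j.factorial) *
        transported hg 3 w z (2 * M + 5) ((lieD hf ^ j) W) p -
      p.1 ^ (2 * M + 5) * P p.2) (2 * M + 6) := by
  have hwc : Continuous w := continuous_iff_continuousAt.2 fun s => (hw s).continuousAt
  set R := 2 * M + 5 with hR
  have hUv : ∀ j, VanishesBelow hf hg x₀ (M + 2 - j) ((lieD hf ^ j) W) := fun j => h.lieD_pow j
  choose e he hd using fun j =>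
    exists_hasDerivWithinAt_transported hf hg hz (by lia) hw hw' R ((lieD hf ^ j) W)
  have hdall : ∀ᶠ h in 𝓝[>] (0 : ℝ), ∀ j ∈ Finset.range (M + 2), ∀ s ∈ Icc (0 : ℝ) 1,
      HasDerivWithinAt (fun s => transported hg 3 w z R ((lieD hf ^ j) W) (h, s))
        (h ^ 2 * (∑ i ∈ Finset.range (R + 1), (h ^ 3 * w s) ^ i / i.factorial *
          transported hg 3 w z R (bracketD hf hg i ((lieD hf ^ j) W)) (h, s)) + e j (h, s))
        (Icc 0 1) s :=
    (Finset.eventually_all _).2 fun j _ => hd j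
  set D : ℕ → ℝ × ℝ → ℝ := fun j p => ∑ i ∈ Finset.range R, p.1 ^ 2 *
    ((p.1 ^ 3 * w p.2) ^ (i + 1) / (i + 1).factorial *
      transported hg 3 w z R (bracketD hf hg (i + 1) ((lieD hf ^ j) W)) p) + e j p with hD
  have hweight : ∀ j : ℕ,
      IsOrder (fun p => (p.1 ^ 2) ^ j * ((1 - p.2) ^ j / j.factorial)) (2 * j) :=
    fun j => (((isOrder_fst_pow 2).pow j).mul
      ((isOrder_snd (by fun_prop : Continuous fun s : ℝ => (1 - s) ^ j)).div_const
        (j.factorial : ℝ)) : IsOrder _ (2 * j + 0))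
  have hfirst : IsOrder (fun p => (p.1 ^ 2) ^ (M + 1 + 1) * ((1 - p.2) ^ (M + 1) /
      (M + 1).factorial) * transported hg 3 w z R ((lieD hf ^ (M + 1 + 1)) W) p)
        (2 * M + 6) := by
    have h1 : VanishesBelow hf hg x₀ 1 ((lieD hf ^ (M + 1 + 1)) W) := vanishesBelow_one hpow
    exact ((((isOrder_fst_pow 2).pow (M + 1 + 1)).mul
      ((isOrder_snd (by fun_prop : Continuous fun s : ℝ => (1 - s) ^ (M + 1))).div_const
        ((M + 1).factorial : ℝ))).mul
      (h1.isOrder_transported_three hz hw hw' hw0 (by lia))).mono (by lia)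
  have hDj : ∀ j, j ≤ M → IsOrder (fun p => D j p - p.1 ^ (2 * (M - j) + 5) *
      (w p.2 * (p.2 ^ (M - j) / (M - j).factorial) * mixedCoeff hf hg x₀ W (M - j) j))
      (2 * (M - j) + 6) := by
    intro j hj
    have h1 : VanishesBelow hf hg x₀ (M - j + 2) ((lieD hf ^ j) W) := by
      convert hUv j using 1
      lia
    refine ((h1.isOrder_sum_bracketD (R := R) hz hw hw' hw0 (by lia)).add
      ((he j).mono (by lia))).congr fun p => ?_
    simp only [hD, mixedCoeff]
    ring
  have hDlast : IsOrder (D (M + 1)) 4 := by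
    refine IsOrder.add (IsOrder.sum fun i _ => ?_) ((he _).mono (by lia))
    exact (isOrder_bracket_term hwc (i + 1) (isOrder_transported hz hwc R _)).mono (by lia)
  have hmain : IsOrder (fun p => (p.1 ^ 2) ^ (M + 1 + 1) * ((1 - p.2) ^ (M + 1) /
      (M + 1).factorial) * transported hg 3 w z R ((lieD hf ^ (M + 1 + 1)) W) p +
      ∑ j ∈ Finset.range (M + 1 + 1), (p.1 ^ 2) ^ j * ((1 - p.2) ^ j / j.factorial) * D j p -
      p.1 ^ (2 * M + 5) * (w p.2 * (mixedPoly hf hg x₀ W M).eval p.2)) (2 * M + 6) := by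
    have h1 : IsOrder (fun p => ∑ j ∈ Finset.range (M + 1),
        (p.1 ^ 2) ^ j * ((1 - p.2) ^ j / j.factorial) * (D j p - p.1 ^ (2 * (M - j) + 5) *
      (w p.2 * (p.2 ^ (M - j) / (M - j).factorial) * mixedCoeff hf hg x₀ W (M - j) j)))
        (2 * M + 6) := by
      refine IsOrder.sum fun j hj => ?_
      have hj' : j ≤ M := Nat.lt_succ_iff.1 (Finset.mem_range.1 hj)
      exact ((hweight j).mul (hDj j hj')).mono (by lia)
    have h2 := ((hweight (M + 1)).mul hDlast).mono (show 2 * M + 6 ≤ _ by lia)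
    refine ((hfirst.add h1).add h2).congr fun p => ?_
    rw [Finset.sum_range_succ _ (M + 1)]
    simp only [mul_sub, Finset.sum_sub_distrib]
    rw [sum_weights_mul_eq_eval_mixedPoly]
    ring
  refine IsOrder.of_hasDerivWithinAt hmain ?_
  filter_upwards [hdall, hz.initial] with h hd h0
  refine ⟨?_, fun s hs => ?_⟩
  · simp only [hP0, mul_zero, sub_zero]
    refine Finset.sum_eq_zero fun j hj => ?_
    have hj' : j < M + 1 + 1 := Finset.mem_range.1 hj
    have := (hUv j).apply_eq_zero (by lia)
    rw [transported_of_eq_zero _ _ hw0, h0, this, mul_zero]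
  · refine HasDerivWithinAt.sub ?_ ((hP s).const_mul (h ^ (2 * M + 5))).hasDerivWithinAt
    refine hasDerivWithinAt_sum_telescope
      (φ := fun j s => transported hg 3 w z R ((lieD hf ^ j) W) (h, s))
      (D := fun j => D j (h, s)) (M + 1) (fun j hj => ?_)
    refine (hd j (Finset.mem_range.2 (by lia)) s hs).congr_deriv ?_
    rw [Finset.sum_range_succ', mul_add, Finset.mul_sum]
    simp only [hD, pow_zero, Nat.factorial_zero, Nat.cast_one, div_one, one_mul, bracketD_zero,
      pow_succ' (lieD hf), Module.End.mul_apply]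
    ring

end MixedWords

/-! ### Local flows -/

section Flow

variable {E : Type*} [NormedAddCommGroup E] [NormedSpace ℝ E] {f g : E → E} {x₀ : E}
  {a ε : ℝ} {u : ℝ → ℝ} {α : E → ℝ → E}

/-- `α` is a continuous family of solutions on `[0, ε]` for the control `u`, one for each initial
state in the ball of radius `a / 2` about `x₀`, that stay in the ball of radius `a`. -/
structure IsLocalFlow (f g : E → E) (u : ℝ → ℝ) (x₀ : E) (a ε : ℝ) (α : E → ℝ → E) : Prop where
  initial : ∀ y ∈ Metric.closedBall x₀ (a / 2), α y 0 = y
  mem : ∀ y ∈ Metric.closedBall x₀ (a / 2), ∀ t ∈ Icc 0 ε, α y t ∈ Metric.closedBall x₀ a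
  deriv : ∀ y ∈ Metric.closedBall x₀ (a / 2), ∀ t ∈ Icc 0 ε,
    HasDerivWithinAt (α y) (f (α y t) + u t • g (α y t)) (Icc 0 ε) t
  continuousOn : ContinuousOn (fun y => α y ε) (Metric.closedBall x₀ (a / 2))

/-- The local flow of the Picard-Lindelöf theorem, Lipschitz in the initial point, stays in the
ball on which the vector field is controlled. -/
lemma exists_flow_mem_closedBall [CompleteSpace E] {F : ℝ → E → E} {tmin tmax : ℝ}
    {t₀ : Icc tmin tmax} {r R L K : NNReal} (hF : IsPicardLindelof F t₀ x₀ R r L K) :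
    ∃ α : E → ℝ → E, (∀ x ∈ Metric.closedBall x₀ (r : ℝ), α x t₀ = x ∧
      ∀ t ∈ Icc tmin tmax, HasDerivWithinAt (α x) (F t (α x t)) (Icc tmin tmax) t ∧
        α x t ∈ Metric.closedBall x₀ (R : ℝ)) ∧
      ∃ L' : NNReal, ∀ t ∈ Icc tmin tmax,
        LipschitzOnWith L' (α · t) (Metric.closedBall x₀ (r : ℝ)) := by
  classical
  have (x) (hx : x ∈ Metric.closedBall x₀ (r : ℝ)) := ODE.FunSpace.exists_isFixedPt_next hF hx
  choose α hα using this
  set α' := fun (x : E) ↦ if hx : x ∈ Metric.closedBall x₀ (r : ℝ) then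
    α x hx |>.compProj else 0 with hα'
  refine ⟨α', fun x hx ↦ ⟨?_, fun t ht ↦ ⟨?_, ?_⟩⟩, ?_⟩
  · rw [hα']
    beta_reduce
    rw [dif_pos hx, ODE.FunSpace.compProj_val, ← hα, ODE.FunSpace.next_apply₀]
  · rw [hα']
    beta_reduce
    rw [dif_pos hx, ODE.FunSpace.compProj_apply]
    apply ODE.hasDerivWithinAt_picard_Icc t₀.2 hF.continuousOn_uncurry
      (α x hx |>.continuous_compProj.continuousOn)
      (fun _ ht' ↦ α x hx |>.compProj_mem_closedBall hF.mul_max_le)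
      x ht |>.congr_of_mem _ ht
    intro t' ht'
    nth_rw 1 [← hα]
    rw [ODE.FunSpace.compProj_of_mem ht', ODE.FunSpace.next_apply]
  · rw [hα']
    beta_reduce
    rw [dif_pos hx]
    exact (α x hx).compProj_mem_closedBall hF.mul_max_le
  · obtain ⟨L', h⟩ := ODE.FunSpace.exists_forall_closedBall_funSpace_dist_le_mul hF
    refine ⟨L', fun t ht ↦ LipschitzOnWith.of_dist_le_mul fun x hx y hy ↦ ?_⟩
    simp_rw [hα']
    rw [dif_pos hx, dif_pos hy, ODE.FunSpace.compProj_apply, ODE.FunSpace.compProj_apply,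
      ← ODE.FunSpace.toContinuousMap_apply_eq_apply,
      ← ODE.FunSpace.toContinuousMap_apply_eq_apply]
    have : Nonempty (Icc tmin tmax) := ⟨t₀⟩
    apply ContinuousMap.dist_le_iff_of_nonempty.mp
    exact h x y hx hy (α x hx) (α y hy) (hα x hx) (hα y hy)

lemma exists_isLocalFlow [FiniteDimensional ℝ E] (hf : ContDiff ℝ 1 f) (hg : ContDiff ℝ 1 g)
    (hu : Continuous u) (ha : 0 < a) (hε : 0 < ε) {L : ℝ}
    (hL : ∀ t ∈ Icc 0 ε, ∀ y ∈ Metric.closedBall x₀ a, ‖f y + u t • g y‖ ≤ L)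
    (hLε : L * ε ≤ a / 2) : ∃ α, IsLocalFlow f g u x₀ a ε α := by
  have := FiniteDimensional.complete ℝ E
  have := FiniteDimensional.proper ℝ E
  have hB : IsCompact (Metric.closedBall x₀ a) := isCompact_closedBall x₀ a
  obtain ⟨Kf, hKf⟩ := hf.contDiffOn.exists_lipschitzOnWith one_ne_zero (convex_closedBall x₀ a) hB
  obtain ⟨Kg, hKg⟩ := hg.contDiffOn.exists_lipschitzOnWith one_ne_zero (convex_closedBall x₀ a) hB
  obtain ⟨C, hC⟩ := isCompact_Icc.exists_bound_of_continuousOn (s := Icc (0 : ℝ) ε)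
    hu.continuousOn
  have hL0 : 0 ≤ L := (norm_nonneg _).trans
    (hL 0 ⟨le_rfl, hε.le⟩ x₀ (Metric.mem_closedBall_self ha.le))
  have h0 : (0 : ℝ) ∈ Icc 0 ε := ⟨le_rfl, hε.le⟩
  have hpl : IsPicardLindelof (fun t y => f y + u t • g y) (⟨0, h0⟩ : Icc (0 : ℝ) ε) x₀
      a.toNNReal (a / 2).toNNReal L.toNNReal (Kf + C.toNNReal * Kg) := by
    refine ⟨fun t ht => ?_, fun y _ => by fun_prop, fun t ht y hy => ?_, ?_⟩
    · rw [Real.coe_toNNReal _ ha.le]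
      refine LipschitzOnWith.of_dist_le_mul fun y hy y' hy' => ?_
      have h1 := hKf.norm_sub_le hy hy'
      have h2 := hKg.norm_sub_le hy hy'
      have h3 : |u t| ≤ (C.toNNReal : ℝ) := (hC t ht).trans (Real.le_coe_toNNReal C)
      rw [dist_eq_norm, dist_eq_norm, add_sub_add_comm, ← smul_sub]
      calc _ ≤ ‖f y - f y'‖ + |u t| * ‖g y - g y'‖ := by
            refine (norm_add_le _ _).trans ?_
            rw [norm_smul, Real.norm_eq_abs]
        _ ≤ Kf * ‖y - y'‖ + C.toNNReal * (Kg * ‖y - y'‖) := by gcongr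
        _ = _ := by push_cast; ring
    · rw [Real.coe_toNNReal _ ha.le] at hy
      exact (hL t ht y hy).trans (Real.le_coe_toNNReal L)
    · have hr : ((a / 2).toNNReal : ℝ) = a / 2 := Real.coe_toNNReal _ (by positivity)
      rw [hr, Real.coe_toNNReal _ ha.le, Real.coe_toNNReal _ hL0]
      simp only [sub_zero, sub_self]
      rw [max_eq_left hε.le]
      linarith
  obtain ⟨α, hα, L', hL'⟩ := exists_flow_mem_closedBall hpl
  rw [Real.coe_toNNReal a ha.le, Real.coe_toNNReal (a / 2) (by positivity)] at hα
  rw [Real.coe_toNNReal (a / 2) (by positivity)] at hL'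
  exact ⟨α, fun y hy => (hα y hy).1, fun y hy t ht => ((hα y hy).2 t ht).2,
    fun y hy t ht => ((hα y hy).2 t ht).1, (hL' ε ⟨hε.le, le_rfl⟩).continuousOn⟩

/-! ### Decrease of the Lyapunov function along short trajectories -/

/-- If the first nonvanishing iterated derivative of `W` along the trajectory is negative, then `W`
decreases. -/
lemma apply_lt_of_lieD_pow_neg {X : E → E} (hX : ContDiff ℝ ∞ X) {N : ℕ} {x : ℝ → E} {B : Set E}
    (hx0 : x 0 = x₀) (hxB : ∀ t ∈ Icc 0 ε, x t ∈ B)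
    (hx : ∀ t ∈ Icc 0 ε, HasDerivWithinAt x (X (x t)) (Icc 0 ε) t) (W : smoothFunctions E)
    (hW : ∀ i, 1 ≤ i → i ≤ N → ((lieD hX ^ i) W).1 x₀ = 0)
    (hneg : ∀ y ∈ B, ((lieD hX ^ (N + 1)) W).1 y < 0) :
    ∀ t ∈ Ioc 0 ε, W.1 (x t) < W.1 x₀ := by
  have key : ∀ U : smoothFunctions E, (∀ t ∈ Ioo 0 ε, (lieD hX U).1 (x t) < 0) →
      ∀ t ∈ Ioc 0 ε, U.1 (x t) < U.1 x₀ := by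
    intro U hU t ht
    have hd : ∀ s ∈ Icc 0 ε, HasDerivWithinAt (fun s => U.1 (x s)) ((lieD hX U).1 (x s))
        (Icc 0 ε) s := fun s hs => hasDerivWithinAt_apply (hx s hs) U
    have hanti : StrictAntiOn (fun s => U.1 (x s)) (Icc 0 ε) := by
      refine strictAntiOn_of_deriv_neg (convex_Icc 0 ε)
        (fun s hs => (hd s hs).continuousWithinAt) fun s hs => ?_
      rw [interior_Icc] at hs
      rw [((hd s (Ioo_subset_Icc_self hs)).hasDerivAt (Icc_mem_nhds hs.1 hs.2)).deriv]
      exact hU s hs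
    have := hanti (left_mem_Icc.2 (ht.1.le.trans ht.2)) (Ioc_subset_Icc_self ht) ht.1
    simpa only [hx0] using this
  induction N generalizing W with
  | zero =>
    refine key W fun t ht => ?_
    simpa using hneg _ (hxB t (Ioo_subset_Icc_self ht))
  | succ N ih =>
    refine key W fun t ht => ?_
    have h1 := ih (lieD hX W) (fun i hi hiN => ?_) (fun y hy => ?_) t (Ioo_subset_Ioc_self ht)
    · have h2 := hW 1 le_rfl (by lia)
      rw [pow_one] at h2
      rwa [h2] at h1
    · have := hW (i + 1) (by lia) (by lia)
      rwa [pow_succ, Module.End.mul_apply] at this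
    · have := hneg y hy
      rwa [pow_succ, Module.End.mul_apply] at this

/-- There are arbitrarily short flows near `x₀`, confined to arbitrarily small balls, that decrease
`W` from `x₀`. -/
def HasDescent (f g : E → E) (W : E → ℝ) (x₀ : E) : Prop :=
  ∀ a₀ : ℝ, 0 < a₀ → ∀ ξ : ℝ, 0 < ξ → ∃ a ε : ℝ, 0 < a ∧ a ≤ a₀ ∧ 0 < ε ∧ ε ≤ ξ ∧
    ∃ u : ℝ → ℝ, Continuous u ∧ ∃ α, IsLocalFlow f g u x₀ a ε α ∧ W (α x₀ ε) < W x₀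

lemma exists_isLocalFlow_const [FiniteDimensional ℝ E] (hf : ContDiff ℝ 1 f)
    (hg : ContDiff ℝ 1 g) (x₀ : E) (ha : 0 < a) (κ : ℝ) {ξ : ℝ} (hξ : 0 < ξ) :
    ∃ ε, 0 < ε ∧ ε ≤ ξ ∧ ∃ α, IsLocalFlow f g (fun _ => κ) x₀ a ε α := by
  have := FiniteDimensional.proper ℝ E
  obtain ⟨L, hL⟩ := (isCompact_closedBall x₀ a).exists_bound_of_continuousOn
    (f := fun y => f y + κ • g y) (by
      have := hf.continuous
      have := hg.continuous
      fun_prop)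
  have hL0 : 0 ≤ L := (norm_nonneg _).trans (hL x₀ (Metric.mem_closedBall_self ha.le))
  have hε : 0 < min ξ (a / 2 / (L + 1)) := by positivity
  refine ⟨min ξ (a / 2 / (L + 1)), hε, min_le_left _ _, ?_⟩
  refine exists_isLocalFlow hf hg continuous_const ha hε (fun t _ y hy => hL y hy) ?_
  calc L * min ξ (a / 2 / (L + 1)) ≤ L * (a / 2 / (L + 1)) := by
        gcongr
        exact min_le_right _ _
    _ ≤ (L + 1) * (a / 2 / (L + 1)) := by gcongr; linarith
    _ = a / 2 := by field_simp

lemma hasDescent_of_const [FiniteDimensional ℝ E] (hf : ContDiff ℝ ∞ f) (hg : ContDiff ℝ ∞ g)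
    (κ : ℝ) {N : ℕ} (hX : ContDiff ℝ ∞ fun y => f y + κ • g y) (W : smoothFunctions E)
    (hW : ∀ i, 1 ≤ i → i ≤ N → ((lieD hX ^ i) W).1 x₀ = 0)
    (hneg : ((lieD hX ^ (N + 1)) W).1 x₀ < 0) : HasDescent f g W.1 x₀ := by
  intro a₀ ha₀ ξ hξ
  have hev : ∀ᶠ y in 𝓝 x₀, ((lieD hX ^ (N + 1)) W).1 y < 0 :=
    (contDiff_coe _).continuous.continuousAt.eventually_lt_const hneg
  obtain ⟨a₁, ha₁, h₁⟩ := Metric.nhds_basis_closedBall.eventually_iff.1 hev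
  have ha : 0 < min a₀ a₁ := lt_min ha₀ ha₁
  obtain ⟨ε, hε, hεξ, α, hα⟩ := exists_isLocalFlow_const (hf.of_le (by simp)) (hg.of_le (by simp))
    x₀ ha κ hξ
  have hx₀ : x₀ ∈ Metric.closedBall x₀ (min a₀ a₁ / 2) :=
    Metric.mem_closedBall_self (by positivity)
  refine ⟨min a₀ a₁, ε, ha, min_le_left _ _, hε, hεξ, _, continuous_const, α, hα, ?_⟩
  exact apply_lt_of_lieD_pow_neg hX (hα.initial x₀ hx₀) (hα.mem x₀ hx₀) (hα.deriv x₀ hx₀) W hW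
    (fun y hy => h₁ (Metric.closedBall_subset_closedBall (min_le_right _ _) hy)) ε ⟨hε, le_rfl⟩

lemma exists_isScaledFamily [FiniteDimensional ℝ E] (hf : ContDiff ℝ 1 f) (hg : ContDiff ℝ 1 g)
    (x₀ : E) (ha : 0 < a) {b : ℕ} (hb : 1 ≤ b) {w w' : ℝ → ℝ} (hw' : Continuous w') :
    ∃ α : ℝ → E → ℝ → E,
      (∀ᶠ h in 𝓝[>] (0 : ℝ),
        IsLocalFlow f g (fun t => -(h ^ b / h ^ 2 * w' (t / h ^ 2))) x₀ a (h ^ 2) (α h)) ∧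
      IsScaledFamily f g x₀ a b w w' (fun h s => α h x₀ (h ^ 2 * s)) := by
  have := FiniteDimensional.proper ℝ E
  have hB := isCompact_closedBall x₀ a
  obtain ⟨Mf, hMf⟩ := hB.exists_bound_of_continuousOn hf.continuous.continuousOn
  obtain ⟨Mg, hMg⟩ := hB.exists_bound_of_continuousOn hg.continuous.continuousOn
  obtain ⟨C, hC⟩ := isCompact_Icc.exists_bound_of_continuousOn (s := Icc (0 : ℝ) 1)
    hw'.continuousOn
  have hC0 : 0 ≤ C := (norm_nonneg _).trans (hC 0 ⟨le_rfl, zero_le_one⟩)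
  have hlim : Tendsto (fun h : ℝ => h ^ 2 * Mf + h ^ b * (C * Mg)) (𝓝[>] 0) (𝓝 0) := by
    have : Tendsto (fun h : ℝ => h ^ 2 * Mf + h ^ b * (C * Mg)) (𝓝 0)
        (𝓝 ((0 : ℝ) ^ 2 * Mf + 0 ^ b * (C * Mg))) := Continuous.tendsto (by fun_prop) 0
    rw [zero_pow (by lia), zero_pow (by lia)] at this
    simpa using this.mono_left nhdsWithin_le_nhds
  have hflow : ∀ᶠ h in 𝓝[>] (0 : ℝ), ∃ α : E → ℝ → E,
      IsLocalFlow f g (fun t => -(h ^ b / h ^ 2 * w' (t / h ^ 2))) x₀ a (h ^ 2) α := by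
    filter_upwards [hlim.eventually_lt_const (u := a / 2) (by positivity), self_mem_nhdsWithin]
      with h hh (h0 : 0 < h)
    refine exists_isLocalFlow hf hg (by fun_prop) ha (by positivity)
      (L := Mf + h ^ b / h ^ 2 * C * Mg) (fun t ht y hy => ?_) ?_
    · have h1 : |w' (t / h ^ 2)| ≤ C := hC _ ⟨div_nonneg ht.1 (by positivity),
        (div_le_one (by positivity)).2 ht.2⟩
      calc _ ≤ ‖f y‖ + |h ^ b / h ^ 2 * w' (t / h ^ 2)| * ‖g y‖ := by
            refine (norm_add_le _ _).trans ?_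
            rw [norm_smul, Real.norm_eq_abs, abs_neg]
        _ = ‖f y‖ + h ^ b / h ^ 2 * |w' (t / h ^ 2)| * ‖g y‖ := by
            rw [abs_mul, abs_of_pos (by positivity : 0 < h ^ b / h ^ 2)]
        _ ≤ _ := by
            gcongr
            exacts [hMf y hy, hMg y hy]
    · have : (Mf + h ^ b / h ^ 2 * C * Mg) * h ^ 2 = h ^ 2 * Mf + h ^ b * (C * Mg) := by
        field_simp
      rw [this]
      exact hh.le
  choose! α hα using fun h (hh : ∃ α : E → ℝ → E,
    IsLocalFlow f g (fun t => -(h ^ b / h ^ 2 * w' (t / h ^ 2))) x₀ a (h ^ 2) α) => hh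
  have hα' : ∀ᶠ h in 𝓝[>] (0 : ℝ),
      IsLocalFlow f g (fun t => -(h ^ b / h ^ 2 * w' (t / h ^ 2))) x₀ a (h ^ 2) (α h) :=
    hflow.mono hα
  have hx₀ : x₀ ∈ Metric.closedBall x₀ (a / 2) := Metric.mem_closedBall_self (by positivity)
  have hmaps : ∀ h : ℝ, 0 < h → MapsTo (fun s => h ^ 2 * s) (Icc 0 1) (Icc 0 (h ^ 2)) :=
    fun h h0 s hs => ⟨by have := hs.1; positivity, by
      have := hs.2
      have h2 : 0 < h ^ 2 := by positivity
      nlinarith⟩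
  refine ⟨α, hα', ?_, ?_, ?_⟩
  · filter_upwards [hα'] with h hh
    simpa using hh.initial x₀ hx₀
  · filter_upwards [hα', self_mem_nhdsWithin] with h hh (h0 : 0 < h) s hs
    exact hh.mem x₀ hx₀ _ (hmaps h h0 hs)
  · filter_upwards [hα', self_mem_nhdsWithin] with h hh (h0 : 0 < h) s hs
    have h1 := hh.deriv x₀ hx₀ _ (hmaps h h0 hs)
    have h2 : HasDerivWithinAt (fun s : ℝ => h ^ 2 * s) (h ^ 2) (Icc 0 1) s := by
      simpa using ((hasDerivAt_id s).const_mul (h ^ 2)).hasDerivWithinAt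
    refine (h1.scomp s h2 (hmaps h h0)).congr_deriv ?_
    have h3 : h ^ 2 * s / h ^ 2 = s := by field_simp
    have h4 : h ^ 2 * (h ^ b / h ^ 2 * w' s) = h ^ b * w' s := by field_simp
    rw [h3, smul_add, smul_smul, mul_neg, h4, neg_smul, sub_eq_add_neg]

lemma hasDescent_of_scaled [FiniteDimensional ℝ E] (hf : ContDiff ℝ 1 f) (hg : ContDiff ℝ 1 g)
    {b : ℕ} (hb : 1 ≤ b) {w w' : ℝ → ℝ} (hw' : Continuous w') (W : E → ℝ)
    (h : ∀ (a : ℝ) (z : ℝ → ℝ → E), IsScaledFamily f g x₀ a b w w' z →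
      ∀ᶠ h in 𝓝[>] (0 : ℝ), W (z h 1) - W x₀ < 0) : HasDescent f g W x₀ := by
  intro a₀ ha₀ ξ hξ
  obtain ⟨α, hα, hz⟩ := exists_isScaledFamily hf hg x₀ ha₀ hb hw' (w := w)
  have hsmall : ∀ᶠ h in 𝓝[>] (0 : ℝ), h ^ 2 < ξ := by
    have : Tendsto (fun h : ℝ => h ^ 2) (𝓝 0) (𝓝 (0 ^ 2)) := Continuous.tendsto (by fun_prop) 0
    exact (this.mono_left nhdsWithin_le_nhds).eventually_lt_const (by simpa using hξ)
  obtain ⟨r, ⟨⟨hr1, hr2⟩, hr3⟩, hr0⟩ := (((hα.and hsmall).and (h a₀ _ hz)).and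
    self_mem_nhdsWithin).exists
  have hr0 : 0 < r := hr0
  refine ⟨a₀, r ^ 2, ha₀, le_rfl, by positivity, hr2.le, _, by fun_prop, α r, hr1, ?_⟩
  simpa using hr3

end Flow

/-! ### The sign conditions imply descent -/

section Conditions

variable {E : Type*} [NormedAddCommGroup E] [NormedSpace ℝ E] {f g : E → E} {x₀ : E}

lemma coe_wordD (hf : ContDiff ℝ ∞ f) (hg : ContDiff ℝ ∞ g) (J : List ℕ)
    (W : smoothFunctions E) :
    (wordD hf hg J W).1 = alongList (J.map (iterBracket f g)) W.1 := by
  induction J with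
  | nil => rfl
  | cons i J ih =>
    have : wordD hf hg (i :: J) W = bracketD hf hg i (wordD hf hg J W) := by simp [wordD]
    rw [this, bracketD, coe_lieD, ih]
    rfl

lemma alongList_eq_zero_of_mem {l : List (E → E)} (h : (0 : E → E) ∈ l) (W : E → ℝ) :
    alongList l W = 0 := by
  induction l with
  | nil => simp at h
  | cons X l ih =>
    change along X (alongList l W) = 0
    ext x
    rcases List.mem_cons.1 h with h | h
    · simp [along, ← h]
    · simp [along, ih h]

lemma iterBracket_mem_lieLayer (f g : E → E) (i : ℕ) :
    iterBracket f g i ∈ lieLayer f g (i + 1) := by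
  induction i with
  | zero => exact Submodule.subset_span (by simp [iterBracket])
  | succ i ih =>
    rw [iterBracket_succ]
    exact Submodule.subset_span ⟨_, ih, g, Submodule.subset_span (by simp), rfl⟩

lemma hasOrderWithoutG_iterBracket {i : ℕ} (h : iterBracket f g i ≠ 0) :
    HasOrderWithoutG f g (iterBracket f g i) (i + 1) := by
  refine ⟨iterBracket f g i, ?_, h, 0, Submodule.zero_mem _, by simp⟩
  cases i with
  | zero => exact Submodule.mem_span_singleton_self f
  | succ i => exact iterBracket_mem_lieLayer f g (i + 1)

/-- The hypothesis speaks of nonzero vector fields of a given order; a word with a vanishing bracket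
annihilates every function anyway. -/
lemma VanishesToOrder.vanishesBelow {N : ℕ} {W : smoothFunctions E} (hf : ContDiff ℝ ∞ f)
    (hg : ContDiff ℝ ∞ g) (h : VanishesToOrder f g W.1 N x₀) :
    VanishesBelow hf hg x₀ (N + 1) (W - constFn (W.1 x₀)) := by
  refine vanishesBelow_sub_constFn fun J hJ hsum => ?_
  rw [coe_wordD]
  by_cases h0 : (0 : E → E) ∈ J.map (iterBracket f g)
  · rw [alongList_eq_zero_of_mem h0]
    rfl
  · have h1 := h.2.2 (J.map fun i => (iterBracket f g i, i + 1)) (by simpa using hJ)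
      (fun p hp => ?_) ?_
    · simpa [Function.comp_def] using h1
    · obtain ⟨i, hi, rfl⟩ := List.mem_map.1 hp
      exact hasOrderWithoutG_iterBracket fun h2 => h0 (List.mem_map.2 ⟨i, hi, h2⟩)
    · rw [List.map_map]
      exact Nat.lt_succ_iff.1 hsum

lemma continuous_eval_mul (p q : Polynomial ℝ) : Continuous fun s => p.eval s * q.eval s := by
  fun_prop

lemma hasDerivAt_integral_zero {φ : ℝ → ℝ} (h : Continuous φ) (s : ℝ) :
    HasDerivAt (fun s => ∫ r in (0 : ℝ)..s, φ r) (φ s) s :=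
  (h.integral_hasStrictDerivAt 0 s).hasDerivAt

lemma transported_sub_constFn_one (hg : ContDiff ℝ ∞ g) {b R : ℕ} {w : ℝ → ℝ} {z : ℝ → ℝ → E}
    (hw : w 1 = 0) (W : smoothFunctions E) (h : ℝ) :
    transported hg b w z R (W - constFn (W.1 x₀)) (h, 1) = W.1 (z h 1) - W.1 x₀ := by
  rw [transported_of_eq_zero _ _ hw]
  simp

variable [FiniteDimensional ℝ E]

/-- Controls of size `h⁻¹` move the state in the direction `σ ^ N [[…[f, g], …], g]`. -/
lemma hasDescent_of_bracket (hf : ContDiff ℝ ∞ f) (hg : ContDiff ℝ ∞ g) {N : ℕ}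
    {W : smoothFunctions E} (h : VanishesToOrder f g W.1 N x₀) {σ : ℝ}
    (hσ : σ ^ N * along (iterBracket f g N) W.1 x₀ < 0) : HasDescent f g W.1 x₀ := by
  have := FiniteDimensional.proper ℝ E
  have hwd : ∀ s : ℝ, HasDerivAt (fun s => σ * (s * (1 - s))) (σ * (1 - 2 * s)) s := fun s => by
    refine (((hasDerivAt_id s).mul ((hasDerivAt_id s).const_sub 1)).const_mul σ).congr_deriv ?_
    simp only [id]
    ring
  -- the primitive vanishes at both ends, where the transported function is `W` itself
  refine hasDescent_of_scaled (hf.of_le (by simp)) (hg.of_le (by simp)) (b := 1) le_rfl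
    (w := fun s => σ * (s * (1 - s))) (w' := fun s => σ * (1 - 2 * s)) (by fun_prop) W.1
    fun a z hz => ?_
  have h1 := isOrder_transported_sub_bracket (h.vanishesBelow hf hg) hz hwd (by fun_prop)
    (by simp) (P := fun s => ∫ r in (0 : ℝ)..s, (σ * (r * (1 - r))) ^ N)
    (hasDerivAt_integral_zero (by fun_prop)) (by simp)
  have hpos : 0 < ∫ r in (0 : ℝ)..1, (r * (1 - r)) ^ N := by
    refine intervalIntegral.intervalIntegral_pos_of_pos_on
      (Continuous.intervalIntegrable (by fun_prop) _ _) (fun r hr => ?_) one_pos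
    have h1 := hr.1
    have h2 := sub_pos.2 hr.2
    positivity
  have hval : (bracketD hf hg N (W - constFn (W.1 x₀))).1 x₀ =
      along (iterBracket f g N) W.1 x₀ := by
    rw [map_sub, bracketD, lieD_constFn, sub_zero, coe_lieD]
  have hneg := h1.eventually_neg (P := fun s => (bracketD hf hg N (W - constFn (W.1 x₀))).1 x₀ /
    N.factorial * ∫ r in (0 : ℝ)..s, (σ * (r * (1 - r))) ^ N) ?_
  · filter_upwards [hneg] with r hr
    rwa [transported_sub_constFn_one hg (by simp)] at hr
  · simp only [hval, mul_pow _ _ N, intervalIntegral.integral_const_mul]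
    have hfac : (0 : ℝ) < N.factorial := by positivity
    have : along (iterBracket f g N) W.1 x₀ / N.factorial *
        (σ ^ N * ∫ r in (0 : ℝ)..1, (r ^ N * (1 - r) ^ N)) =
        σ ^ N * along (iterBracket f g N) W.1 x₀ *
          ((∫ r in (0 : ℝ)..1, (r ^ N * (1 - r) ^ N)) / N.factorial) := by ring
    rw [this]
    refine mul_neg_of_neg_of_pos hσ (div_pos ?_ hfac)
    simpa only [mul_pow] using hpos

/-- Controls of size `h`, when the drift alone has no effect up to the order in question. -/
lemma hasDescent_of_mixed (hf : ContDiff ℝ ∞ f) (hg : ContDiff ℝ ∞ g) {M : ℕ}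
    {W : smoothFunctions E} (h : VanishesToOrder f g W.1 (M + 1) x₀)
    (hpow : (along f)^[M + 2] W.1 x₀ = 0)
    (hne : along (iterBracket g f (M + 1)) W.1 x₀ ≠ 0) : HasDescent f g W.1 x₀ := by
  have := FiniteDimensional.proper ℝ E
  have hvan := h.vanishesBelow hf hg
  set W₀ := W - constFn (W.1 x₀) with hW₀
  set Q := mixedPoly hf hg x₀ W₀ M with hQ
  have hQ0 : Q ≠ 0 := by
    intro h0
    have h1 := coeff_mixedPoly (x₀ := x₀) (W := W₀) hf hg M
    rw [← hQ, h0, Polynomial.coeff_zero, bracketD, hW₀, map_sub, lieD_constFn, sub_zero,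
      coe_lieD] at h1
    have h2 : (-1 : ℝ) ^ (M + 1) / M.factorial ≠ 0 :=
      div_ne_zero (pow_ne_zero _ (by norm_num)) (by positivity)
    exact mul_ne_zero h2 hne h1.symm
  have hpow₀ : ((lieD hf ^ (M + 2)) W₀).1 x₀ = 0 := by
    have h1 : (lieD hf ^ (M + 2)) W₀ = (lieD hf ^ (M + 2)) W := by
      rw [hW₀, map_sub, pow_succ, Module.End.mul_apply, Module.End.mul_apply, lieD_constFn,
        map_zero, sub_zero]
    rw [h1, coe_lieD_pow, hpow]
  -- a primitive that vanishes at both ends and makes the integral against `Q` negative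
  set w : Polynomial ℝ := -(Polynomial.X * (1 - Polynomial.X) * Q) with hw
  have hw0 : w.eval 0 = 0 := by simp [hw]
  have hw1 : w.eval 1 = 0 := by simp [hw]
  refine hasDescent_of_scaled (hf.of_le (by simp)) (hg.of_le (by simp)) (b := 3) (by lia)
    (w := fun s => w.eval s) (w' := fun s => w.derivative.eval s)
    w.derivative.continuous W.1 fun a z hz => ?_
  have h1 := isOrder_telescope_sub hvan hpow₀ hz (fun s => w.hasDerivAt s)
    w.derivative.continuous hw0 (P := fun s => ∫ r in (0 : ℝ)..s, w.eval r * Q.eval r)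
    (hasDerivAt_integral_zero (continuous_eval_mul w Q)) (by simp)
  have hneg := h1.eventually_neg (P := fun s => ∫ r in (0 : ℝ)..s, w.eval r * Q.eval r) ?_
  · filter_upwards [hneg] with r hr
    rw [Finset.sum_range_succ', Finset.sum_eq_zero] at hr
    · simpa [transported_sub_constFn_one hg (w := fun s => w.eval s) hw1, hW₀] using hr
    · intro j _
      simp
  · have hroot : ∃ s ∈ Ioo (0 : ℝ) 1, Q.eval s ≠ 0 := by
      by_contra! hall
      refine hQ0 (Q.eq_zero_of_infinite_isRoot ((Ioo_infinite (zero_lt_one (α := ℝ))).mono ?_))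
      intro s hs
      exact hall s hs
    obtain ⟨s, hs, hsQ⟩ := hroot
    have hpos : 0 < ∫ r in (0 : ℝ)..1, r * (1 - r) * Q.eval r ^ 2 := by
      refine intervalIntegral.integral_pos zero_lt_one
        (Continuous.continuousOn (by fun_prop)) (fun r hr => ?_)
        ⟨s, Ioo_subset_Icc_self hs, ?_⟩
      · have h1 := hr.1
        have h2 := sub_nonneg.2 hr.2
        positivity
      · have h1 := hs.1
        have h2 := sub_pos.2 hs.2
        positivity
    have : ∀ r : ℝ, w.eval r * Q.eval r = -(r * (1 - r) * Q.eval r ^ 2) := fun r => by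
      simp only [hw, Polynomial.eval_neg, Polynomial.eval_mul, Polynomial.eval_X,
        Polynomial.eval_sub, Polynomial.eval_one]
      ring
    simp only [this, intervalIntegral.integral_neg]
    linarith

lemma hasDescent_of_conditions (hf : ContDiff ℝ ∞ f) (hg : ContDiff ℝ ∞ g)
    {V : E → ℝ} (hV : ContDiff ℝ ∞ V)
    (h : along g V x₀ = 0 → along f V x₀ < 0 ∨
      ∃ N : ℕ, 1 ≤ N ∧ VanishesToOrder f g V N x₀ ∧
        ((along f)^[N + 1] V x₀ < 0 ∨
         (Odd N ∧ along (iterBracket f g N) V x₀ ≠ 0) ∨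
         (Even N ∧ along (iterBracket f g N) V x₀ < 0) ∨
         ((along f)^[N + 1] V x₀ = 0 ∧ along (iterBracket g f N) V x₀ ≠ 0))) :
    HasDescent f g V x₀ := by
  set W : smoothFunctions E := ⟨V, mem_smoothFunctions.2 hV⟩ with hW
  have hX : ∀ κ : ℝ, ContDiff ℝ ∞ fun y => f y + κ • g y := fun κ => by fun_prop
  have hdrift : ∀ N, (∀ i : ℕ, 1 ≤ i → i ≤ N → (along f)^[i] V x₀ = 0) →
      (along f)^[N + 1] V x₀ < 0 → HasDescent f g V x₀ := by
    intro N hN hneg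
    have he : (fun y => f y + (0 : ℝ) • g y) = f := by simp
    refine hasDescent_of_const hf hg 0 (N := N) (hX 0) W (fun i hi hiN => ?_) ?_
    · rw [coe_lieD_pow, he]
      exact hN i hi hiN
    · rw [coe_lieD_pow, he]
      exact hneg
  by_cases hgV : along g V x₀ = 0
  · rcases h hgV with hfV | ⟨N, hN, hvan, hP⟩
    · exact hdrift 0 (fun i hi hi0 => absurd (hi.trans hi0) (by simp)) (by simpa using hfV)
    · rcases hP with h1 | ⟨hodd, h2⟩ | ⟨heven, h3⟩ | ⟨h4, h5⟩
      · exact hdrift N hvan.2.1 h1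
      · refine hasDescent_of_bracket (W := W) hf hg hvan
          (σ := -SignType.sign (along (iterBracket f g N) V x₀)) ?_
        rcases h2.lt_or_gt with hlt | hgt
        · simpa [sign_neg hlt] using hlt
        · simpa [sign_pos hgt, hodd.neg_one_pow] using hgt
      · exact hasDescent_of_bracket (W := W) hf hg hvan (σ := 1) (by simpa using h3)
      · obtain ⟨M, rfl⟩ : ∃ M, N = M + 1 := ⟨N - 1, by lia⟩
        exact hasDescent_of_mixed (W := W) hf hg hvan h4 h5
  · -- a constant control outweighs the drift
    set κ := -(along f V x₀ + 1) / along g V x₀ with hκ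
    refine hasDescent_of_const hf hg κ (N := 0) (hX κ) W
      (fun i hi hi0 => absurd (hi.trans hi0) (by simp)) ?_
    have h1 : ((lieD (hX κ) ^ (0 + 1)) W).1 x₀ = along f V x₀ + κ * along g V x₀ := by
      simp [along, hW]
    rw [h1, hκ, div_mul_cancel₀ _ hgV]
    linarith

end Conditions

/-! ### Steering by locally bounded controls -/

section Controls

/-- Measurable controls that are bounded on bounded sets of times. -/
def IsLocallyBoundedControl (u : ℝ → ℝ) : Prop :=
  Measurable u ∧ ∀ b : ℝ, ∃ C : ℝ, ∀ t, |t| ≤ b → |u t| ≤ C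

lemma IsLocallyBoundedControl.isAdmissibleOn {u : ℝ → ℝ} (h : IsLocallyBoundedControl u)
    (s : Set ℝ) : IsAdmissibleOn u s := by
  refine ⟨h.1.aestronglyMeasurable, fun a b _ => ?_⟩
  obtain ⟨C, hC⟩ := h.2 (max |a| |b|)
  refine ⟨C, (ae_restrict_iff' measurableSet_Icc).2 (Eventually.of_forall fun t ht => hC t ?_)⟩
  exact abs_le_max_abs_abs ht.1 ht.2

lemma isLocallyBoundedControl_of_continuous {u : ℝ → ℝ} (h : Continuous u) :
    IsLocallyBoundedControl u := by
  refine ⟨h.measurable, fun b => ?_⟩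
  obtain ⟨C, hC⟩ := (isCompact_Icc (a := -b) (b := b)).exists_bound_of_continuousOn h.continuousOn
  exact ⟨C, fun t ht => hC t (abs_le.1 ht)⟩

lemma IsLocallyBoundedControl.comp_add_right {u : ℝ → ℝ} (h : IsLocallyBoundedControl u) (c : ℝ) :
    IsLocallyBoundedControl fun t => u (t + c) := by
  refine ⟨h.1.comp (measurable_add_const c), fun b => ?_⟩
  obtain ⟨C, hC⟩ := h.2 (b + |c|)
  exact ⟨C, fun t ht => hC _ ((abs_add_le t c).trans (by gcongr))⟩

lemma IsLocallyBoundedControl.ite {u v : ℝ → ℝ} (hu : IsLocallyBoundedControl u)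
    (hv : IsLocallyBoundedControl v) (c : ℝ) :
    IsLocallyBoundedControl fun t => if t < c then u t else v t := by
  refine ⟨Measurable.ite measurableSet_Iio hu.1 hv.1, fun b => ?_⟩
  obtain ⟨C, hC⟩ := hu.2 b
  obtain ⟨C', hC'⟩ := hv.2 b
  refine ⟨max C C', fun t ht => ?_⟩
  beta_reduce
  split_ifs
  · exact (hC t ht).trans (le_max_left _ _)
  · exact (hC' t ht).trans (le_max_right _ _)

end Controls

section Steering

variable {E : Type*} [NormedAddCommGroup E] [NormedSpace ℝ E] {f g : E → E} {S S' : Set E}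
  {θ θ₁ θ₂ : ℝ} {y z z' : E} {V : E → ℝ}

/-- Some control steers `z` to `y` in time `θ` inside the set `S`. -/
def Steers (f g : E → E) (S : Set E) (θ : ℝ) (z y : E) : Prop :=
  ∃ (u : ℝ → ℝ) (x : ℝ → E), IsLocallyBoundedControl u ∧
    IsTrajectoryOn (affineSystem f g) u 0 θ x ∧ x 0 = z ∧ x θ = y ∧ ∀ s ∈ Icc 0 θ, x s ∈ S

lemma Steers.mono (h : Steers f g S θ z y) (hS : S ⊆ S') : Steers f g S' θ z y := by
  obtain ⟨u, x, hu, hx, h0, hθ, hxS⟩ := h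
  exact ⟨u, x, hu, hx, h0, hθ, fun s hs => hS (hxS s hs)⟩

lemma Steers.truncate (h : Steers f g S θ z y) (h0 : 0 ≤ θ₁) (h1 : θ₁ ≤ θ) :
    ∃ y' ∈ S, Steers f g S θ₁ z y' := by
  obtain ⟨u, x, hu, hx, hx0, -, hxS⟩ := h
  exact ⟨x θ₁, hxS θ₁ ⟨h0, h1⟩, u, x, hu, hx.mono le_rfl h0 h1, hx0, rfl,
    fun s hs => hxS s ⟨hs.1, hs.2.trans h1⟩⟩

lemma steers_zero (hz : z ∈ S) : Steers f g S 0 z z :=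
  ⟨fun _ => 0, fun _ => z, isLocallyBoundedControl_of_continuous continuous_const,
    isTrajectoryOn_self _ _ _ _, rfl, rfl, fun _ _ => hz⟩

lemma Steers.trans (h₁ : Steers f g S θ₁ z z') (h₂ : Steers f g S θ₂ z' y) (hθ₁ : 0 ≤ θ₁)
    (hθ₂ : 0 ≤ θ₂) : Steers f g S (θ₁ + θ₂) z y := by
  obtain ⟨u₁, x₁, hu₁, hx₁, h10, h11, hS₁⟩ := h₁
  obtain ⟨u₂, x₂, hu₂, hx₂, h20, h21, hS₂⟩ := h₂
  have hx₂' := hx₂.comp_add_right (-θ₁)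
  simp only [sub_neg_eq_add, zero_add] at hx₂'
  rw [add_comm θ₂ θ₁] at hx₂'
  have hle : θ₁ ≤ θ₁ + θ₂ := by linarith
  set u := fun t => if t < θ₁ then u₁ t else u₂ (t + -θ₁) with hu
  set x := fun t => if t ≤ θ₁ then x₁ t else x₂ (t + -θ₁) with hx
  have e₁ : EqOn x₁ x (Icc 0 θ₁) := fun t ht => by simp [hx, ht.2]
  have e₂ : EqOn (fun t => x₂ (t + -θ₁)) x (Icc θ₁ (θ₁ + θ₂)) := fun t ht => by
    rcases ht.1.eq_or_lt with rfl | hlt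
    · simp [hx, h20, h11]
    · simp [hx, not_le.2 hlt]
  refine ⟨u, x, hu₁.ite (hu₂.comp_add_right (-θ₁)) θ₁, ?_, ?_, ?_, fun s hs => ?_⟩
  · refine IsTrajectoryOn.append (b := θ₁) ?_ ?_ hθ₁ hle
    · exact hx₁.congr hθ₁ (fun t ht => by simp [hu, ht.2]) e₁
    · exact hx₂'.congr hle (fun t ht => by simp [hu, not_lt.2 ht.1.le]) e₂
  · rw [← e₁ ⟨le_rfl, hθ₁⟩, h10]
  · rw [← e₂ ⟨hle, le_rfl⟩]
    simpa using h21
  · rcases le_total s θ₁ with h | h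
    · rw [← e₁ ⟨hs.1, h⟩]
      exact hS₁ s ⟨hs.1, h⟩
    · rw [← e₂ ⟨h, hs.2⟩]
      exact hS₂ _ ⟨by linarith, by linarith [hs.2]⟩

lemma IsLocalFlow.isTrajectoryOn [FiniteDimensional ℝ E] {u : ℝ → ℝ} {x₀ : E} {a ε : ℝ}
    {α : E → ℝ → E} (h : IsLocalFlow f g u x₀ a ε α) (hf : ContDiff ℝ 1 f)
    (hg : ContDiff ℝ 1 g) (hu : Continuous u) (hε : 0 ≤ ε)
    (hy : y ∈ Metric.closedBall x₀ (a / 2)) :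
    IsTrajectoryOn (affineSystem f g) u 0 ε (α y) := by
  have := FiniteDimensional.complete ℝ E
  exact isTrajectoryOn_of_hasDerivWithinAt hf.continuous hg.continuous hu hε (h.deriv y hy)

/-- A flow from `HasDescent` with the bounds on `V` along it. -/
lemma HasDescent.exists_flow [FiniteDimensional ℝ E] {x₀ : E} (h : HasDescent f g V x₀)
    (hV : Continuous V) (hpos : 0 < V x₀) {ξ : ℝ} (hξ : 0 < ξ) :
    ∃ a ε : ℝ, 0 < a ∧ 0 < ε ∧ ε ≤ ξ ∧ ∃ u : ℝ → ℝ, Continuous u ∧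
      ∃ α, IsLocalFlow f g u x₀ a ε α ∧ V (α x₀ ε) < V x₀ ∧
        ∀ y ∈ Metric.closedBall x₀ (a / 2), ∀ s ∈ Icc 0 ε, V (α y s) ≤ 2 * V y := by
  have hev : ∀ᶠ y in 𝓝 x₀, V y ∈ Ioo (3 / 4 * V x₀) (3 / 2 * V x₀) :=
    hV.continuousAt.eventually_mem (Ioo_mem_nhds (by linarith) (by linarith))
  obtain ⟨a₀, ha₀, h₀⟩ := Metric.nhds_basis_closedBall.eventually_iff.1 hev
  obtain ⟨a, ε, ha, haa, hε, hεξ, u, hu, α, hα, hlt⟩ := h a₀ ha₀ ξ hξ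
  refine ⟨a, ε, ha, hε, hεξ, u, hu, α, hα, hlt, fun y hy s hs => ?_⟩
  have h1 := (h₀ (Metric.closedBall_subset_closedBall haa (hα.mem y hy s hs))).2
  have h2 := (h₀ (Metric.closedBall_subset_closedBall (by linarith) hy)).1
  linarith

lemma lyapunovAssumptionWith_of_hasDescent [FiniteDimensional ℝ E] (hf : ContDiff ℝ 1 f)
    (hg : ContDiff ℝ 1 g) (hV : Continuous V) (hpos : IsPosDef V)
    (h : ∀ x, x ≠ 0 → HasDescent f g V x) :
    LyapunovAssumptionWith (affineSystem f g) V (fun s => 2 * s) where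
  continuous := hV
  posDef := hpos
  classK := ⟨by fun_prop, fun s _ t _ hst => by simpa using hst, by simp⟩
  decrease ξ hξ x₀ hx₀ := by
    obtain ⟨a, ε, ha, hε, hεξ, u, hu, α, hα, hlt, hle⟩ :=
      (h x₀ hx₀).exists_flow hV (hpos.2 x₀ hx₀) hξ
    have hmem : x₀ ∈ Metric.closedBall x₀ (a / 2) := Metric.mem_closedBall_self (by positivity)
    have hadm := (isLocallyBoundedControl_of_continuous hu).isAdmissibleOn (Icc 0 ε)
    have htraj := hα.isTrajectoryOn hf hg hu hε.le hmem
    have h0 := hα.initial x₀ hmem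
    refine ⟨ε, hε, hεξ, u, hadm, ⟨α x₀, htraj, h0⟩, fun x hx hx0 => ?_⟩
    have heq := hx.eqOn hf hg hadm htraj (hx0.trans h0.symm)
    refine ⟨?_, fun s hs => ?_⟩
    · rw [heq ⟨hε.le, le_rfl⟩]
      exact hlt
    · rw [heq hs]
      exact hle x₀ hmem s hs

/-! ### Uniform decrease on sublevel sets -/

lemma IsProper.isCompact_sublevel {E : Type*} [NormedAddCommGroup E] [ProperSpace E]
    {V : E → ℝ} (hp : IsProper V) (hV : Continuous V) (c : ℝ) :
    IsCompact {x | V x ≤ c} := by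
  have h1 : ∀ᶠ x in cocompact E, c < V x := hp.eventually_gt_atTop c
  obtain ⟨K, hK, hKc⟩ := mem_cocompact.1 h1
  refine hK.of_isClosed_subset (isClosed_le hV continuous_const) fun x hx => ?_
  by_contra hxK
  have h2 : c < V x := hKc hxK
  exact absurd h2 (not_lt.2 hx)

variable [FiniteDimensional ℝ E]

/-- Near every state, steps of a fixed duration decrease `V` by a fixed amount, or keep it below
`c / 4`. -/
lemma exists_step_nhds (hf : ContDiff ℝ 1 f) (hg : ContDiff ℝ 1 g) (hV : Continuous V)
    (hpos : IsPosDef V) (h : ∀ x, x ≠ 0 → HasDescent f g V x) {c : ℝ} (hc : 0 < c) (x₀ : E) :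
    ∃ U ∈ 𝓝 x₀, ∃ ε η : ℝ, 0 < ε ∧ ε ≤ 1 ∧ 0 < η ∧ ∀ y ∈ U, ∃ y',
      Steers f g {x | V x ≤ max (2 * V y) (c / 4)} ε y y' ∧ V y' ≤ max (V y - η) (c / 4) := by
  rcases lt_or_ge (V x₀) (c / 4) with hlt | hge
  · obtain ⟨a, ha, h₀⟩ := Metric.nhds_basis_closedBall.eventually_iff.1
      (hV.continuousAt.eventually_lt_const hlt)
    obtain ⟨ε, hε, hε1, α, hα⟩ := exists_isLocalFlow_const hf hg x₀ ha 0 one_pos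
    refine ⟨_, Metric.closedBall_mem_nhds x₀ (half_pos ha), ε, 1, hε, hε1, one_pos,
      fun y hy => ⟨α y ε, ⟨fun _ => 0, α y, isLocallyBoundedControl_of_continuous continuous_const,
        hα.isTrajectoryOn hf hg continuous_const hε.le hy, hα.initial y hy, rfl, fun s hs => ?_⟩,
        ?_⟩⟩
    · exact (h₀ (hα.mem y hy s hs)).le.trans (le_max_right _ _)
    · exact (h₀ (hα.mem y hy ε ⟨hε.le, le_rfl⟩)).le.trans (le_max_right _ _)
  · have hx₀ : x₀ ≠ 0 := by
      rintro rfl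
      rw [hpos.1] at hge
      linarith
    obtain ⟨a, ε, ha, hε, hε1, u, hu, α, hα, hlt, hle⟩ :=
      (h x₀ hx₀).exists_flow hV (hpos.2 x₀ hx₀) one_pos
    have hball := Metric.closedBall_mem_nhds x₀ (half_pos ha)
    have hcont : ContinuousAt (fun y => V (α y ε) - V y) x₀ :=
      (hV.continuousAt.comp (hα.continuousOn.continuousAt hball)).sub hV.continuousAt
    obtain ⟨η, hη, hη'⟩ := exists_between (sub_neg.2 hlt)
    have hev := hcont.eventually_lt_const hη
    refine ⟨_, inter_mem hball hev, ε, -η, hε, hε1, by linarith, fun y hy => ⟨α y ε,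
      ⟨u, α y, isLocallyBoundedControl_of_continuous hu,
        hα.isTrajectoryOn hf hg hu hε.le hy.1, hα.initial y hy.1, rfl, fun s hs => ?_⟩, ?_⟩⟩
    · exact (hle y hy.1 s hs).trans (le_max_left _ _)
    · have : V (α y ε) - V y < η := hy.2
      exact le_max_of_le_left (by linarith)

lemma exists_uniform_step (hf : ContDiff ℝ 1 f) (hg : ContDiff ℝ 1 g) (hV : Continuous V)
    (hpos : IsPosDef V) (hp : IsProper V) (h : ∀ x, x ≠ 0 → HasDescent f g V x) {c : ℝ}
    (hc : 0 < c) :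
    ∃ ε₀ η : ℝ, 0 < ε₀ ∧ 0 < η ∧ ∀ y, V y ≤ c → ∃ ε, ε₀ ≤ ε ∧ ε ≤ 1 ∧ ∃ y',
      Steers f g {x | V x ≤ max (2 * V y) (c / 4)} ε y y' ∧ V y' ≤ max (V y - η) (c / 4) := by
  have := FiniteDimensional.proper ℝ E
  refine (hp.isCompact_sublevel hV c).induction_on (p := fun s => ∃ ε₀ η : ℝ, 0 < ε₀ ∧ 0 < η ∧
    ∀ y ∈ s, ∃ ε, ε₀ ≤ ε ∧ ε ≤ 1 ∧ ∃ y', Steers f g {x | V x ≤ max (2 * V y) (c / 4)} ε y y' ∧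
      V y' ≤ max (V y - η) (c / 4)) ⟨1, 1, one_pos, one_pos, by simp⟩ ?_ ?_ ?_
  · rintro s t hst ⟨ε₀, η, hε₀, hη, ht⟩
    exact ⟨ε₀, η, hε₀, hη, fun y hy => ht y (hst hy)⟩
  · rintro s t ⟨ε₁, η₁, hε₁, hη₁, hs⟩ ⟨ε₂, η₂, hε₂, hη₂, ht⟩
    refine ⟨min ε₁ ε₂, min η₁ η₂, lt_min hε₁ hε₂, lt_min hη₁ hη₂, ?_⟩
    rintro y (hy | hy)
    · obtain ⟨ε, h1, h2, y', h3, h4⟩ := hs y hy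
      refine ⟨ε, (min_le_left _ _).trans h1, h2, y', h3, h4.trans ?_⟩
      gcongr
      exact min_le_left _ _
    · obtain ⟨ε, h1, h2, y', h3, h4⟩ := ht y hy
      refine ⟨ε, (min_le_right _ _).trans h1, h2, y', h3, h4.trans ?_⟩
      gcongr
      exact min_le_right _ _
  · intro x _
    obtain ⟨U, hU, ε, η, hε, hε1, hη, hstep⟩ := exists_step_nhds hf hg hV hpos h hc x
    exact ⟨U, mem_nhdsWithin_of_mem_nhds hU, ε, η, hε, hη,
      fun y hy => ⟨ε, le_rfl, hε1, hstep y hy⟩⟩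

/-- In a time that depends only on the level `c`, the sublevel set of `c` is steered into the
sublevel set of `c / 2`. -/
lemma exists_halving_time (hf : ContDiff ℝ 1 f) (hg : ContDiff ℝ 1 g) (hV : Continuous V)
    (hpos : IsPosDef V) (hp : IsProper V) (h : ∀ x, x ≠ 0 → HasDescent f g V x) {c : ℝ}
    (hc : 0 < c) :
    ∃ θ : ℝ, 1 ≤ θ ∧ ∀ z, V z ≤ c → ∃ y, V y ≤ c / 2 ∧ Steers f g {x | V x ≤ 2 * c} θ z y := by
  obtain ⟨ε₀, η, hε₀, hη, hstep⟩ := exists_uniform_step hf hg hV hpos hp h hc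
  -- once below `c / 4`, the level `c / 2` is never exceeded again
  have hold : ∀ k : ℕ, ∀ θ, 0 ≤ θ → θ ≤ k * ε₀ → ∀ y, V y ≤ c / 4 →
      ∃ y' ∈ {x | V x ≤ c / 2}, Steers f g {x | V x ≤ c / 2} θ y y' := by
    intro k
    induction k with
    | zero =>
      intro θ h0 h1 y hy
      obtain rfl : θ = 0 := le_antisymm (by simpa using h1) h0
      have : y ∈ {x | V x ≤ c / 2} := hy.trans (by linarith)
      exact ⟨y, this, steers_zero this⟩
    | succ k ih =>
      intro θ h0 h1 y hy
      obtain ⟨ε, hε, hε1, y', hs, hy'⟩ := hstep y (by linarith)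
      have hs' : Steers f g {x | V x ≤ c / 2} ε y y' := hs.mono fun x (hx : V x ≤ _) =>
        hx.trans (max_le (by linarith) (by linarith))
      rcases le_total θ ε with hle | hle
      · exact hs'.truncate h0 hle
      · push_cast at h1
        obtain ⟨y'', hy'', hs''⟩ := ih (θ - ε) (by linarith) (by linarith) y'
          (hy'.trans (max_le (by linarith) le_rfl))
        refine ⟨y'', hy'', ?_⟩
        have := hs'.trans hs'' (by linarith) (by linarith)
        rwa [add_sub_cancel] at this
  have descend : ∀ k : ℕ, ∀ θ : ℝ, k ≤ θ → ∀ y, V y ≤ c → V y ≤ c / 4 + k * η →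
      ∃ y', V y' ≤ c / 2 ∧ Steers f g {x | V x ≤ 2 * c} θ y y' := by
    intro k
    induction k with
    | zero =>
      intro θ hθ y _ hy
      obtain ⟨m, hm⟩ := exists_nat_ge (θ / ε₀)
      obtain ⟨y', hy', hs⟩ := hold m θ (by simpa using hθ) ((div_le_iff₀ hε₀).1 hm) y
        (by simpa using hy)
      exact ⟨y', hy', hs.mono fun x (hx : V x ≤ c / 2) => hx.trans (by linarith)⟩
    | succ k ih =>
      intro θ hθ y hyc hy
      push_cast at hθ hy
      obtain ⟨ε, hε, hε1, y', hs, hy'⟩ := hstep y hyc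
      have hkη : 0 ≤ k * η := by positivity
      obtain ⟨y'', hy'', hs''⟩ := ih (θ - ε) (by linarith) y'
        (hy'.trans (max_le (by linarith) (by linarith)))
        (hy'.trans (max_le (by linarith) (by linarith)))
      refine ⟨y'', hy'', ?_⟩
      have hk0 : (0 : ℝ) ≤ k := k.cast_nonneg
      have := (hs.mono fun x (hx : V x ≤ _) => hx.trans
        (max_le (by linarith) (by linarith))).trans hs'' (by linarith) (by linarith)
      rwa [add_sub_cancel] at this
  obtain ⟨k, hk⟩ := exists_nat_ge (c / η)
  rw [div_le_iff₀ hη] at hk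
  exact ⟨max 1 k, le_max_left _ _, fun z hz => descend k _ (le_max_right _ _) z hz (by linarith)⟩

end Steering

/-! ### Gluing along a partition of times -/

section Glue

variable {T : ℕ → ℝ} {s t : ℝ} {i : ℕ}

/-- The index of the sampling interval `[T i, T (i + 1))` that contains `t`; it is `0` for negative
times, so that it is monotone on the whole line. -/
noncomputable def sampleIndex (T : ℕ → ℝ) (t : ℝ) : ℕ := sInf {i | t < T (i + 1)}

lemma IsTimePartition.lt_sampleIndex (hT : IsTimePartition T) (t : ℝ) :
    t < T (sampleIndex T t + 1) := by
  have hne : {i | t < T (i + 1)}.Nonempty :=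
    ((tendsto_add_atTop_iff_nat 1).2 hT.2.2 |>.eventually_gt_atTop t).exists
  exact Nat.sInf_mem hne

lemma IsTimePartition.sampleIndex_le (hT : IsTimePartition T) (ht : 0 ≤ t) :
    T (sampleIndex T t) ≤ t := by
  rcases Nat.eq_zero_or_pos (sampleIndex T t) with h | h
  · rwa [h, hT.1]
  · by_contra! hlt
    have h1 : sampleIndex T t - 1 ∈ {i | t < T (i + 1)} := by
      change t < T (sampleIndex T t - 1 + 1)
      rwa [Nat.sub_add_cancel h]
    have := Nat.sInf_le h1
    change sampleIndex T t ≤ _ at this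
    lia

lemma IsTimePartition.sampleIndex_eq (hT : IsTimePartition T) (ht : t ∈ Ico (T i) (T (i + 1))) :
    sampleIndex T t = i := by
  refine le_antisymm (Nat.sInf_le (show t < T (i + 1) from ht.2)) ?_
  by_contra! hlt
  exact absurd (hT.lt_sampleIndex t) (not_lt.2 ((hT.2.1.monotone hlt).trans ht.1))

lemma IsTimePartition.monotone_sampleIndex (hT : IsTimePartition T) :
    Monotone (sampleIndex T) := fun s t hst =>
  Nat.sInf_le (show s < _ from hst.trans_lt (hT.lt_sampleIndex t))

lemma IsTimePartition.nonneg (hT : IsTimePartition T) (i : ℕ) : 0 ≤ T i := by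
  rw [← hT.1]
  exact hT.2.1.monotone (Nat.zero_le i)

lemma IsTimePartition.isLocallyBoundedControl (hT : IsTimePartition T) {u : ℕ → ℝ → ℝ}
    (hu : ∀ i, IsLocallyBoundedControl (u i)) :
    IsLocallyBoundedControl fun t => u (sampleIndex T t) t := by
  refine ⟨?_, fun b => ?_⟩
  · have h1 : Measurable fun p : ℕ × ℝ => u p.1 p.2 :=
      measurable_from_prod_countable_right fun i => (hu i).1
    exact h1.comp (hT.monotone_sampleIndex.measurable.prodMk measurable_id)
  · choose C hC using fun i => (hu i).2 b
    refine ⟨∑ i ∈ Finset.range (sampleIndex T b + 1), |C i|, fun t ht => ?_⟩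
    have hmem : sampleIndex T t ∈ Finset.range (sampleIndex T b + 1) :=
      Finset.mem_range.2 (Nat.lt_succ_iff.2
        (hT.monotone_sampleIndex ((le_abs_self t).trans ht)))
    exact (hC _ t ht).trans ((le_abs_self _).trans
      (Finset.single_le_sum (f := fun i => |C i|) (fun _ _ => abs_nonneg _) hmem))

/-- Pieces that match at the sampling times are restrictions of one function. -/
lemma IsTimePartition.eqOn_glue {E : Type*} (hT : IsTimePartition T) {X : ℕ → ℝ → E}
    (hX : ∀ i, X i (T (i + 1)) = X (i + 1) (T (i + 1))) (i : ℕ) :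
    EqOn (X i) (fun t => X (sampleIndex T t) t) (Icc (T i) (T (i + 1))) := by
  intro t ht
  rcases ht.2.eq_or_lt with rfl | hlt
  · have : sampleIndex T (T (i + 1)) = i + 1 :=
      hT.sampleIndex_eq ⟨le_rfl, hT.2.1 (Nat.lt_succ_self _)⟩
    simp only [this, hX]
  · simp only [hT.sampleIndex_eq ⟨ht.1, hlt⟩]

variable {E : Type*} [NormedAddCommGroup E] [NormedSpace ℝ E] {F : E → ℝ → E}

lemma IsTimePartition.isTrajectoryOn_of_forall (hT : IsTimePartition T) {u : ℝ → ℝ} {x : ℝ → E}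
    (h : ∀ i, IsTrajectoryOn F u (T i) (T (i + 1)) x) {τ : ℝ} (hτ : 0 ≤ τ) :
    IsTrajectoryOn F u 0 τ x := by
  have h1 : ∀ i, IsTrajectoryOn F u 0 (T i) x := by
    intro i
    induction i with
    | zero =>
      rw [hT.1]
      exact isTrajectoryOn_self _ _ _ _
    | succ i ih => exact ih.append (h i) (hT.nonneg i) (hT.2.1.monotone (Nat.le_succ i))
  exact (h1 _).mono le_rfl hτ (hT.lt_sampleIndex τ).le

end Glue

/-! ### Open-loop controllability with a prescribed rate of decay -/

section OpenLoop

variable {E : Type*} [NormedAddCommGroup E] [NormedSpace ℝ E] {f g : E → E} {V : E → ℝ}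
  {c Θ : ℕ → ℝ} {m m' : ℕ} {t₀ t₁ : ℝ} {z : E}

/-- From the state `z` at time `t₀` some control keeps `V` below `2 c m` for ever and, for each
`i`, below `2 c i` from the time `Θ i` on. -/
def Controllable (f g : E → E) (V : E → ℝ) (c Θ : ℕ → ℝ) (m : ℕ) (t₀ : ℝ) (z : E) : Prop :=
  ∃ (u : ℝ → ℝ) (x : ℝ → E), IsLocallyBoundedControl u ∧
    (∀ τ, t₀ ≤ τ → IsTrajectoryOn (affineSystem f g) u t₀ τ x) ∧ x t₀ = z ∧
    ∀ t, t₀ ≤ t → V (x t) ≤ 2 * c m ∧ ∀ i, Θ i ≤ t → V (x t) ≤ 2 * c i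

lemma Controllable.apply_le (h : Controllable f g V c Θ m t₀ z) : V z ≤ 2 * c m := by
  obtain ⟨u, x, -, -, rfl, h⟩ := h
  exact (h t₀ le_rfl).1

lemma Controllable.mono (h : Controllable f g V c Θ m t₀ z) (hc : Antitone c) (hm : m' ≤ m) :
    Controllable f g V c Θ m' t₀ z := by
  obtain ⟨u, x, hu, hx, h0, h⟩ := h
  exact ⟨u, x, hu, hx, h0, fun t ht => ⟨(h t ht).1.trans (by linarith [hc hm]), (h t ht).2⟩⟩

/-- The bounds become weaker when the motion starts earlier. -/
lemma Controllable.earlier (h : Controllable f g V c Θ m t₀ z) (ht : t₁ ≤ t₀) :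
    Controllable f g V c Θ m t₁ z := by
  obtain ⟨u, x, hu, hx, h0, h⟩ := h
  refine ⟨fun t => u (t + (t₀ - t₁)), fun t => x (t + (t₀ - t₁)), hu.comp_add_right _,
    fun τ hτ => ?_, by simpa using h0, fun t ht' => ?_⟩
  · have := (hx (τ + (t₀ - t₁)) (by linarith)).comp_add_right (t₀ - t₁)
    simpa using this
  · have := h (t + (t₀ - t₁)) (by linarith)
    exact ⟨this.1, fun i hi => this.2 i (by linarith)⟩

lemma controllable_zero (hf0 : f 0 = 0) (hV0 : V 0 = 0) (hc : ∀ i, 0 ≤ c i) (m : ℕ) (t₀ : ℝ) :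
    Controllable f g V c Θ m t₀ 0 := by
  refine ⟨fun _ => 0, fun _ => 0, isLocallyBoundedControl_of_continuous continuous_const,
    fun τ _ => ⟨continuousOn_const, ?_, ?_⟩, rfl, fun t _ => ?_⟩
  · simp [affineSystem, hf0]
  · simp [affineSystem, hf0]
  · rw [hV0]
    exact ⟨by linarith [hc m], fun i _ => by linarith [hc i]⟩

/-- One control realizes, up to the time `t₁`, all the bounds that are achievable from `z`: for
`z ≠ 0` only finitely many `m` are achievable, and a control for the largest of them serves all. -/
lemma exists_optimal_control (hf0 : f 0 = 0) (hpos : IsPosDef V) (hc0 : ∀ i, 0 ≤ c i)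
    (hc : Antitone c) (hc' : Tendsto c atTop (𝓝 0)) (ht : t₀ ≤ t₁)
    (hz : Controllable f g V c Θ 0 t₀ z) :
    ∃ (u : ℝ → ℝ) (x : ℝ → E), IsLocallyBoundedControl u ∧
      IsTrajectoryOn (affineSystem f g) u t₀ t₁ x ∧ x t₀ = z ∧
      ∀ m, Controllable f g V c Θ m t₀ z →
        (∀ t ∈ Icc t₀ t₁, V (x t) ≤ 2 * c m ∧ ∀ i, Θ i ≤ t → V (x t) ≤ 2 * c i) ∧
        Controllable f g V c Θ m t₁ (x t₁) := by
  by_cases hz0 : z = 0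
  · subst hz0
    refine ⟨fun _ => 0, fun _ => 0, isLocallyBoundedControl_of_continuous continuous_const,
      ⟨continuousOn_const, by simp [affineSystem, hf0], by simp [affineSystem, hf0]⟩, rfl,
      fun m _ => ⟨fun t _ => ?_, controllable_zero hf0 hpos.1 hc0 m t₁⟩⟩
    rw [hpos.1]
    exact ⟨by linarith [hc0 m], fun i _ => by linarith [hc0 i]⟩
  · have hVz := hpos.2 z hz0
    obtain ⟨K, hK⟩ := (hc'.eventually_lt_const (half_pos hVz)).exists_forall_of_atTop
    classical
    have hbound : ∀ m, Controllable f g V c Θ m t₀ z → m ≤ K := fun m hm => by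
      by_contra! hlt
      have h1 := hK m hlt.le
      have h2 := hm.apply_le
      linarith
    set M := Nat.findGreatest (fun m => Controllable f g V c Θ m t₀ z) K with hM
    have hMc : Controllable f g V c Θ M t₀ z :=
      Nat.findGreatest_spec (P := fun m => Controllable f g V c Θ m t₀ z) (Nat.zero_le K) hz
    obtain ⟨u, x, hu, hx, h0, h⟩ := hMc
    refine ⟨u, x, hu, hx t₁ ht, h0, fun m hm => ?_⟩
    have hmM : m ≤ M := Nat.le_findGreatest (hbound m hm) hm
    have hcm := hc hmM
    refine ⟨fun t htt => ⟨(h t htt.1).1.trans (by linarith), (h t htt.1).2⟩, ?_⟩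
    have h1 : Controllable f g V c Θ M t₁ (x t₁) :=
      ⟨u, x, hu, fun τ hτ => (hx τ (ht.trans hτ)).mono ht hτ le_rfl, rfl,
        fun t htt => h t (ht.trans htt)⟩
    exact h1.mono hc hmM

/-- The stages `{V ≤ c i} → {V ≤ c (i + 1)}` are run through one after another, from `i = m` on.
The time `Θ i` allows for the stages before `m` as well, which makes it independent of the initial
state. -/
lemma controllable_of_stages {θ : ℕ → ℝ} (hc : Antitone c) (hθ : ∀ i, 1 ≤ θ i)
    (hstage : ∀ i z, V z ≤ c i → ∃ y, V y ≤ c (i + 1) ∧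
      Steers f g {x | V x ≤ 2 * c i} (θ i) z y)
    (hz : V z ≤ c m) :
    Controllable f g V c (fun i => ∑ l ∈ Finset.range i, θ l) m 0 z := by
  choose! next hnext using hstage
  set Z : ℕ → E := fun j => Nat.rec z (fun j y => next (m + j) y) j with hZ
  have hZc : ∀ j, V (Z j) ≤ c (m + j) := by
    intro j
    induction j with
    | zero => exact hz
    | succ j ih => exact (hnext (m + j) (Z j) ih).1
  have hst : ∀ j, Steers f g {x | V x ≤ 2 * c (m + j)} (θ (m + j)) (Z j) (Z (j + 1)) :=
    fun j => (hnext (m + j) (Z j) (hZc j)).2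
  choose u x hu hx hx0 hx1 hxV using hst
  set T : ℕ → ℝ := fun j => ∑ l ∈ Finset.range j, θ (m + l) with hTdef
  have hTs : ∀ j, T (j + 1) = T j + θ (m + j) := fun j => Finset.sum_range_succ _ _
  have hT : IsTimePartition T := by
    refine ⟨by simp [hTdef], strictMono_nat_of_lt_succ fun j => ?_, ?_⟩
    · rw [hTs]
      linarith [hθ (m + j)]
    · refine tendsto_atTop_mono (fun j => ?_) tendsto_natCast_atTop_atTop
      have := Finset.card_nsmul_le_sum (Finset.range j) (fun l => θ (m + l)) 1
        fun l _ => hθ (m + l)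
      simpa using this
  set X : ℕ → ℝ → E := fun j t => x j (t + -T j) with hXdef
  set U : ℕ → ℝ → ℝ := fun j t => u j (t + -T j) with hUdef
  have hX : ∀ j, X j (T (j + 1)) = X (j + 1) (T (j + 1)) := fun j => by
    simp only [hXdef, add_neg_cancel, hx0]
    rw [hTs, add_neg_cancel_comm, hx1]
  have htraj : ∀ j, IsTrajectoryOn (affineSystem f g) (fun t => U (sampleIndex T t) t) (T j)
      (T (j + 1)) (fun t => X (sampleIndex T t) t) := by
    intro j
    have h1 := (hx j).comp_add_right (-T j)
    simp only [sub_neg_eq_add, zero_add] at h1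
    rw [add_comm (θ (m + j)), ← hTs] at h1
    exact h1.congr (hT.2.1.monotone (Nat.le_succ j))
      (fun t ht => by simp only [hT.sampleIndex_eq (Ioo_subset_Ico_self ht), hUdef])
      (hT.eqOn_glue hX j)
  refine ⟨_, _, hT.isLocallyBoundedControl fun j => (hu j).comp_add_right (-T j),
    fun τ hτ => hT.isTrajectoryOn_of_forall htraj hτ, ?_, fun t ht => ?_⟩
  · have h0 : sampleIndex T 0 = 0 :=
      hT.sampleIndex_eq ⟨hT.1.le, by rw [← hT.1]; exact hT.2.1 (Nat.lt_succ_self 0)⟩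
    simp [h0, hT.1, hXdef, hx0, hZ]
  · set j := sampleIndex T t with hj
    have h1 : T j ≤ t := hT.sampleIndex_le ht
    have h2 : t < T (j + 1) := hT.lt_sampleIndex t
    rw [hTs] at h2
    have hVt : V (X j t) ≤ 2 * c (m + j) := hxV j _ ⟨by linarith, by linarith⟩
    refine ⟨hVt.trans (by linarith [hc (Nat.le_add_right m j)]), fun i hi => hVt.trans ?_⟩
    -- the stage reached at time `t` is not behind the schedule
    have hij : i ≤ m + j := by
      by_contra! hlt
      have h3 : ∑ l ∈ Finset.range (m + (j + 1)), θ l ≤ ∑ l ∈ Finset.range i, θ l :=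
        Finset.sum_le_sum_of_subset_of_nonneg (Finset.range_mono (by lia))
          fun l _ _ => by linarith [hθ l]
      rw [Finset.sum_range_add] at h3
      have h4 : 0 ≤ ∑ l ∈ Finset.range m, θ l :=
        Finset.sum_nonneg fun l _ => by linarith [hθ l]
      have h5 : T (j + 1) = ∑ l ∈ Finset.range (j + 1), θ (m + l) := rfl
      rw [hTs] at h5
      linarith
    linarith [hc hij]

end OpenLoop

/-! ### Sampled-data feedback -/

section Feedback

variable {E : Type*} [NormedAddCommGroup E] [NormedSpace ℝ E] [FiniteDimensional ℝ E]
  {f g : E → E} {V : E → ℝ}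

lemma exists_sublevel_subset_ball (hV : Continuous V) (hpos : IsPosDef V) (hp : IsProper V)
    {ε : ℝ} (hε : 0 < ε) : ∃ δ > 0, ∀ x, V x ≤ δ → ‖x‖ ≤ ε := by
  have := FiniteDimensional.proper ℝ E
  have hK : IsCompact ({x | V x ≤ 1} ∩ {x | ε ≤ ‖x‖}) :=
    (hp.isCompact_sublevel hV 1).inter_right (isClosed_le continuous_const continuous_norm)
  rcases ({x | V x ≤ 1} ∩ {x | ε ≤ ‖x‖}).eq_empty_or_nonempty with he | hne
  · refine ⟨1, one_pos, fun x hx => ?_⟩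
    by_contra! hlt
    have : x ∈ {x | V x ≤ 1} ∩ {x | ε ≤ ‖x‖} := ⟨hx, hlt.le⟩
    rw [he] at this
    exact this
  · obtain ⟨y, hy, hmin⟩ := hK.exists_isMinOn hne hV.continuousOn
    have hy0 : y ≠ 0 := by
      rintro rfl
      have : ε ≤ ‖(0 : E)‖ := hy.2
      rw [norm_zero] at this
      linarith
    have hVy := hpos.2 y hy0
    refine ⟨min 1 (V y / 2), lt_min one_pos (half_pos hVy), fun x hx => ?_⟩
    by_contra! hlt
    have h1 : V y ≤ V x := hmin ⟨hx.trans (min_le_left _ _), hlt.le⟩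
    have h2 := hx.trans (min_le_right _ _)
    linarith

/-- The feedback applies, at each sampled state, an open-loop control that realizes all the bounds
achievable from there. What is achievable is then never lost at the next sampling time, whatever
the partition, so that the closed loop inherits the open-loop bounds. -/
lemma sdfSGAS_of_hasDescent (hf : ContDiff ℝ 1 f) (hg : ContDiff ℝ 1 g) (hf0 : f 0 = 0)
    (hV : Continuous V) (hpos : IsPosDef V) (hp : IsProper V)
    (h : ∀ x, x ≠ 0 → HasDescent f g V x) : SDFSGAS (affineSystem f g) := by
  intro R hR T hT
  have := FiniteDimensional.proper ℝ E
  obtain ⟨C, hC⟩ := (isCompact_closedBall (0 : E) R).exists_bound_of_continuousOn hV.continuousOn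
  set c₀ := max C 1 with hc₀
  have hc₀pos : 0 < c₀ := lt_max_of_lt_right one_pos
  set c : ℕ → ℝ := fun i => c₀ * (1 / 2) ^ i with hcdef
  have hcpos : ∀ i, 0 < c i := fun i => by positivity
  have hcs : ∀ i, c (i + 1) = c i / 2 := fun i => by simp only [hcdef, pow_succ]; ring
  have hcanti : Antitone c := antitone_nat_of_succ_le fun i => by
    rw [hcs]
    linarith [hcpos i]
  have hclim : Tendsto c atTop (𝓝 0) := by
    have h1 := (tendsto_pow_atTop_nhds_zero_of_lt_one (r := (1 / 2 : ℝ)) (by norm_num)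
      (by norm_num)).const_mul c₀
    rwa [mul_zero] at h1
  choose θ hθ hstage using fun i => exists_halving_time hf hg hV hpos hp h (hcpos i)
  set Θ : ℕ → ℝ := fun i => ∑ l ∈ Finset.range i, θ l with hΘ
  have hopen : ∀ m z, V z ≤ c m → Controllable f g V c Θ m 0 z := fun m z hz =>
    controllable_of_stages hcanti hθ (fun i z hz => by rw [hcs]; exact hstage i z hz) hz
  have hopt := fun (i : ℕ) (z : E) (hz : Controllable f g V c Θ 0 (T i) z) =>
    exists_optimal_control hf0 hpos (fun i => (hcpos i).le) hcanti hclim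
      (hT.2.1.monotone (Nat.le_succ i)) hz
  choose! u X hu hX hX0 hXm using hopt
  set P : Set E := {z | Controllable f g V c Θ 0 0 z} with hP
  classical
  set k : ℝ → E → ℝ := fun t z =>
    (fun i => if Controllable f g V c Θ 0 (T i) z then u i z else fun _ => 0)
      (sampleIndex T t) t with hk
  have hkb : ∀ z, IsLocallyBoundedControl fun t => k t z := fun z =>
    hT.isLocallyBoundedControl (u := fun i =>
      if Controllable f g V c Θ 0 (T i) z then u i z else fun _ => 0) fun i => by
      split_ifs with hi
      · exact hu i z hi
      · exact isLocallyBoundedControl_of_continuous continuous_const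
  have hkX : ∀ i z, Controllable f g V c Θ 0 (T i) z →
      IsTrajectoryOn (affineSystem f g) (fun t => k t z) (T i) (T (i + 1)) (X i z) := by
    intro i z hz
    refine (hX i z hz).congr (hT.2.1.monotone (Nat.le_succ i)) (fun t ht => ?_)
      fun _ _ => rfl
    simp only [hk, hT.sampleIndex_eq (Ioo_subset_Ico_self ht), if_pos hz]
  -- every closed-loop trajectory keeps all the bounds achievable from its initial state
  have hclosed : ∀ x : ℝ → E, IsSampledTrajectory (affineSystem f g) P k T x → ∀ m,
      Controllable f g V c Θ m 0 (x 0) → ∀ t, 0 ≤ t →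
        V (x t) ≤ 2 * c m ∧ ∀ i, Θ i ≤ t → V (x t) ≤ 2 * c i := by
    intro x hx m hm
    have heq : ∀ i, Controllable f g V c Θ 0 (T i) (x (T i)) →
        EqOn x (X i (x (T i))) (Icc (T i) (T (i + 1))) := fun i hi =>
      (hx i).2.eqOn hf hg ((hkb _).isAdmissibleOn _) (hkX i _ hi) (hX0 i _ hi).symm
    have hind : ∀ i, Controllable f g V c Θ m (T i) (x (T i)) := by
      intro i
      induction i with
      | zero => rwa [hT.1]
      | succ i ih =>
        have hi := ih.mono hcanti (Nat.zero_le m)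
        rw [heq i hi ⟨hT.2.1.monotone (Nat.le_succ i), le_rfl⟩]
        exact (hXm i _ hi m ih).2
    intro t ht
    have ht' : t ∈ Icc (T (sampleIndex T t)) (T (sampleIndex T t + 1)) :=
      ⟨hT.sampleIndex_le ht, (hT.lt_sampleIndex t).le⟩
    have hi := (hind (sampleIndex T t)).mono hcanti (Nat.zero_le m)
    rw [heq _ hi ht']
    exact (hXm _ _ hi m (hind _)).1 t ht'
  have hball : ∀ z, V z ≤ c₀ → z ∈ P := fun z hz => hopen 0 z (by simpa [hcdef] using hz)
  refine ⟨P, ?_, fun z hz => ?_, k, fun z _ => (hkb z).isAdmissibleOn _, fun x₀ hx₀ => ?_,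
    fun ε hε => ?_, fun x hx => ?_⟩
  · have h1 : ∀ᶠ z in 𝓝 (0 : E), V z < c₀ :=
      hV.continuousAt.eventually_lt_const (by rwa [hpos.1])
    exact h1.mono fun z hz => hball z hz.le
  · exact hball z (((le_abs_self _).trans (hC z hz)).trans (le_max_left _ _))
  · -- sampled states of the closed-loop trajectory from `x₀`
    set Z : ℕ → E := fun j => Nat.rec x₀ (fun j y => X j y (T (j + 1))) j with hZ
    have hZs : ∀ j, Z (j + 1) = X j (Z j) (T (j + 1)) := fun j => rfl
    have hZc : ∀ j, Controllable f g V c Θ 0 (T j) (Z j) := by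
      intro j
      induction j with
      | zero =>
        rw [hT.1]
        exact hx₀
      | succ j ih =>
        rw [hZs]
        exact (hXm j _ ih 0 ih).2
    have hmatch : ∀ j, X j (Z j) (T (j + 1)) = X (j + 1) (Z (j + 1)) (T (j + 1)) := fun j => by
      rw [hX0 (j + 1) _ (hZc (j + 1)), hZs]
    have hglue := hT.eqOn_glue (X := fun j => X j (Z j)) hmatch
    have hval : ∀ j, X (sampleIndex T (T j)) (Z (sampleIndex T (T j))) (T j) = Z j := fun j => by
      rw [hT.sampleIndex_eq ⟨le_rfl, hT.2.1 (Nat.lt_succ_self j)⟩, hX0 j _ (hZc j)]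
    refine ⟨fun t => X (sampleIndex T t) (Z (sampleIndex T t)) t, fun i => ?_, ?_⟩
    · simp only [hval]
      exact ⟨(hZc i).earlier (hT.nonneg i), (hkX i _ (hZc i)).congr
        (hT.2.1.monotone (Nat.le_succ i)) (fun _ _ => rfl) (hglue i)⟩
    · have := hval 0
      rwa [hT.1] at this
  · obtain ⟨δ', hδ', hsub⟩ := exists_sublevel_subset_ball hV hpos hp hε
    obtain ⟨m, hm⟩ := (hclim.eventually_lt_const (half_pos hδ')).exists
    obtain ⟨δ, hδ, hδm⟩ := Metric.nhds_basis_closedBall.eventually_iff.1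
      (hV.continuousAt.eventually_lt_const (show V (0 : E) < c m by rw [hpos.1]; exact hcpos m))
    refine ⟨δ, hδ, fun x hx hx0 t ht => hsub _ ?_⟩
    have h1 : V (x 0) < c m := hδm (by simpa using hx0)
    have h2 := (hclosed x hx m (hopen m _ h1.le) t ht).1
    linarith
  · rw [Metric.tendsto_nhds]
    intro ε hε
    obtain ⟨δ', hδ', hsub⟩ := exists_sublevel_subset_ball hV hpos hp (half_pos hε)
    obtain ⟨i, hi⟩ := (hclim.eventually_lt_const (half_pos hδ')).exists
    have hx0 : Controllable f g V c Θ 0 0 (x 0) := by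
      have := (hx 0).1
      rwa [hT.1] at this
    filter_upwards [eventually_ge_atTop (max 0 (Θ i))] with t ht
    have h1 := (hclosed x hx 0 hx0 t ((le_max_left _ _).trans ht)).2 i
      ((le_max_right _ _).trans ht)
    have h2 := hsub (x t) (by linarith)
    rw [dist_zero_right]
    linarith

/-- A semi-global feedback for each radius gives a weak global one: the sampling period is
constant, and the initial state selects the radius. -/
lemma SDFSGAS.sdfWGAS (hf : ContDiff ℝ 1 f) (hg : ContDiff ℝ 1 g)
    (h : SDFSGAS (affineSystem f g)) : SDFWGAS (affineSystem f g) := by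
  intro τ hτ
  set T : ℕ → ℝ := fun i => i * τ with hTdef
  have hT : IsTimePartition T := by
    refine ⟨by simp [hTdef], strictMono_nat_of_lt_succ fun i => ?_, ?_⟩
    · simp only [hTdef]
      push_cast
      linarith
    · exact tendsto_natCast_atTop_atTop.atTop_mul_const hτ
  choose! P hP hRP k hk hex hstab hatt using fun (R : ℝ) (hR : 0 < R) => h R hR T hT
  set ρ : E → ℝ := fun x₀ => max 1 ‖x₀‖ with hρ
  have hρ0 : ∀ x₀, 0 < ρ x₀ := fun x₀ => lt_max_of_lt_left one_pos
  have hmem : ∀ x₀, x₀ ∈ P (ρ x₀) := fun x₀ =>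
    hRP _ (hρ0 x₀) (by
      rw [mem_closedBall_zero_iff]
      exact le_max_right 1 ‖x₀‖)
  classical
  set κ : ℝ → E → E → ℝ := fun s z x₀ => if z ∈ P (ρ x₀) then k (ρ x₀) s z else 0 with hκ
  have hadm : ∀ z x₀ : E, IsAdmissibleOn (fun s => κ s z x₀) (Ici 0) := by
    intro z x₀
    by_cases hz : z ∈ P (ρ x₀)
    · simpa only [hκ, if_pos hz] using hk _ (hρ0 x₀) z hz
    · simpa only [hκ, if_neg hz] using
        (isLocallyBoundedControl_of_continuous continuous_const).isAdmissibleOn (Ici 0)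
  have hadm' : ∀ z x₀ i, IsAdmissibleOn (fun s => κ s z x₀) (Icc (T i) (T (i + 1))) := by
    intro z x₀ i
    have hsub : Icc (T i) (T (i + 1)) ⊆ Ici 0 := fun t ht => (hT.nonneg i).trans ht.1
    exact ⟨(hadm z x₀).1.mono_set hsub, fun a b hab => (hadm z x₀).2 a b (hab.trans hsub)⟩
  -- by uniqueness, the closed-loop trajectories are those of the selected semi-global feedback
  have hin : ∀ (x₀ : E) (x : ℝ → E),
      IsSampledTrajectory (affineSystem f g) univ (fun s z => κ s z x₀) T x → x 0 = x₀ →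
      IsSampledTrajectory (affineSystem f g) (P (ρ x₀)) (k (ρ x₀)) T x := by
    intro x₀ x hx hx0
    obtain ⟨y, hy, hy0⟩ := hex _ (hρ0 x₀) x₀ (hmem x₀)
    have hyx : ∀ i, x (T i) = y (T i) := by
      intro i
      induction i with
      | zero => rw [hT.1, hx0, hy0]
      | succ i ih =>
        have h1 := (hx i).2
        have h2 := (hy i).2
        simp only [hκ, ih, if_pos (hy i).1] at h1
        have h3 := hadm' (y (T i)) x₀ i
        simp only [hκ, if_pos (hy i).1] at h3
        exact h1.eqOn hf hg h3 h2 ih ⟨hT.2.1.monotone (Nat.le_succ i), le_rfl⟩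
    intro i
    have hPi : x (T i) ∈ P (ρ x₀) := by
      rw [hyx i]
      exact (hy i).1
    have h1 := (hx i).2
    simp only [hκ, if_pos hPi] at h1
    exact ⟨hPi, h1⟩
  refine ⟨fun _ => τ, κ, fun _ => T, fun _ => ⟨hτ, le_rfl⟩, hadm, fun _ => hT, fun x₀ => ?_,
    fun x₀ x _ _ i _ => ?_, fun ε hε => ?_, fun x₀ x hx hx0 => ?_⟩
  · obtain ⟨y, hy, hy0⟩ := hex _ (hρ0 x₀) x₀ (hmem x₀)
    refine ⟨y, fun i => ⟨mem_univ _, ?_⟩, hy0⟩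
    simp only [hκ, if_pos (hy i).1]
    exact (hy i).2
  · simp only [hTdef]
    push_cast
    ring
  · obtain ⟨δ, hδ, hδ'⟩ := hstab 1 one_pos ε hε
    refine ⟨min δ 1, lt_min hδ one_pos, fun x₀ x hx hx0 hn => ?_⟩
    have h1 := hin x₀ x hx hx0
    have h2 : ρ x₀ = 1 := max_eq_left (hn.trans (min_le_right _ _))
    rw [h2] at h1
    exact hδ' x h1 (by rw [hx0]; exact hn.trans (min_le_left _ _))
  · exact hatt _ (hρ0 x₀) x (hin x₀ x hx hx0)

end Feedback

end SampledData

theorem proposition3 (n : ℕ)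
    (f g : EuclideanSpace ℝ (Fin n) → EuclideanSpace ℝ (Fin n))
    (hf : ContDiff ℝ ∞ f) (hg : ContDiff ℝ ∞ g) (hf0 : f 0 = 0)
    (V : EuclideanSpace ℝ (Fin n) → ℝ) (hV : ContDiff ℝ ∞ V)
    (hVpos : SampledData.IsPosDef V) (hVproper : SampledData.IsProper V)
    (h : ∀ x : EuclideanSpace ℝ (Fin n), x ≠ 0 → SampledData.along g V x = 0 →
      SampledData.along f V x < 0 ∨
      ∃ N : ℕ, 1 ≤ N ∧ SampledData.VanishesToOrder f g V N x ∧
        ((SampledData.along f)^[N + 1] V x < 0 ∨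
         (Odd N ∧ SampledData.along (SampledData.iterBracket f g N) V x ≠ 0) ∨
         (Even N ∧ SampledData.along (SampledData.iterBracket f g N) V x < 0) ∨
         ((SampledData.along f)^[N + 1] V x = 0 ∧
           SampledData.along (SampledData.iterBracket g f N) V x ≠ 0))) :
    SampledData.LyapunovAssumptionWith (SampledData.affineSystem f g) V (fun s => 2 * s) ∧
    SampledData.LyapunovAssumption (SampledData.affineSystem f g) ∧
    SampledData.SDFSGAS (SampledData.affineSystem f g) ∧
    SampledData.SDFWGAS (SampledData.affineSystem f g) := by
  have hf1 : ContDiff ℝ 1 f := hf.of_le (by simp)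
  have hg1 : ContDiff ℝ 1 g := hg.of_le (by simp)
  have hdescent : ∀ x, x ≠ 0 → SampledData.HasDescent f g V x := fun x hx =>
    SampledData.hasDescent_of_conditions hf hg hV (h x hx)
  have hL := SampledData.lyapunovAssumptionWith_of_hasDescent hf1 hg1 hV.continuous hVpos hdescent
  have hS := SampledData.sdfSGAS_of_hasDescent hf1 hg1 hf0 hV.continuous hVpos hVproper hdescent
  exact ⟨hL, ⟨V, _, hL⟩, hS, hS.sdfWGAS hf1 hg1⟩
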